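/- **Model.** Consider a two-tier network in the plane. The base stations (BSs) of tier $k\in\{1,2\}$ form independent homogeneous Poisson point processes with densities $\lambda_k>0$, users have density $\lambda_u>0$; BSs of tier $k$ transmit with power $P_k>0$, users with power $P_u>0$; the noise power is $\sigma^2>0$, the path loss is $d^{-\alpha}$ with $\alpha>2$, all fading variables are i.i.d. $\mathrm{Exp}(1)$, and residual self-interferences are nonnegative. The typical user, at the origin, with distance $D_k$ to the closest BS of tier $k$, is associated with the tier $k$ maximizing $P_kD_k^{-\alpha}$ (probability $\mathcal A_k$). It is full-duplex if $P_kD_k^{-\alpha}\ge\gamma_k$ and half-duplex otherwise (probabilities $\mathcal A_k^{\rm FD}$, $\mathcal A_k^{\rm HD}$). Half-duplex users receive on channel 1 and transmit on channel 2; full-duplex users do both on both channels. Conditionally on the mode of the typical user, on its tier $k$ and on its distance $r$ to the serving BS, the interfering BSs and users of each tier $t$ and mode are assumed to form independent inhomogeneous Poisson processes around the receiver, with intensities depending on $r$, on the distance $y$ to the receiver and on $(\gamma_1,\gamma_2)$, and proportional to $\lambda_t\mathcal A_t^{\rm FD}/\mathcal A_t$ for full-duplex, respectively $\lambda_t\mathcal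 A_t^{\rm HD}/\mathcal A_t$ for half-duplex nodes. In the pure half-duplex network, $\gamma_1=\gamma_2=\infty$, there are thus no full-duplex interferers, and the remaining relevant intensities are, for half-duplex BSs (downlink, channel 1), $$\lambda^{\rm BS}_{k,t}(y)=\lambda_t\bigl(1-e^{-\lambda_u\pi\zeta^2}\bigr)\ \text{ for } y\ge r\Bigl(\tfrac{P_t}{P_k}\Bigr)^{1/\alpha},\qquad \zeta=\frac{r+y}{\max\{(P_k/P_t)^{1/\alpha}-1,\,0\}}$$ (no such BS is closer; $\zeta=\infty$ and $\lambda^{\rm BS}_{k,t}=\lambda_t$ if $P_k\le P_t$), and for half-duplex users (uplink, channel 2), $$\lambda^{\rm User}_{k,t}(y)=\lambda_t\Bigl(1-\exp\bigl(-\pi y^2\lambda_t(P_t/P_k)^{2/\alpha}\bigr)\Bigr),\qquad y>0 .$$ The SINR $\theta$ of a link is its received power (transmit power times fading times $r^{-\alpha}$) divided by residual self-interference (for full-duplex users) plus interference plus $\sigma^2$. The spectral efficiency of the typical user is $$S=\sum_{i=1,2}\sum_{k=1,2}\Bigl(\mathcal A_k^{\rm FD}\bigl(S_k^{i,{\rm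 FD,D}}+S_k^{i,{\rm FD,U}}\bigr)+\mathcal A_k^{\rm HD}S_k^{i,{\rm HD}}\Bigr),\qquad S_k^{i,\cdot}=\tfrac12\,\mathbb E\bigl[\log_2(1+\theta_k^{i,\cdot})\bigr],$$ where $\theta_k^{i,\cdot}$ is the SINR on channel $i$ of a typical user of tier $k$ in the given mode (D: downlink, U: uplink). **Statement.** Let $\gamma_1=\gamma_2=\infty$, and let $\bar k$ be the tier other than $k$. Then $\mathcal A_k=\dfrac{\lambda_kP_k^{2/\alpha}}{\lambda_kP_k^{2/\alpha}+\lambda_{\bar k}P_{\bar k}^{2/\alpha}}$, the rates $\log_2(1+\theta_k^{i,{\rm HD}})$ are integrable, and $$S=\frac1{2\ln2}\sum_{k=1,2}\mathcal A_k\int_0^\infty\frac{\mathcal C_k^{1,{\rm HD}}(T)+\mathcal C_k^{2,{\rm HD}}(T)}{1+T}\,dT$$ with convergent integrals, where $\mathcal C_k^{i,{\rm HD}}(T)=\mathbb P(\theta_k^{i,{\rm HD}}>T)$ is given for all $T\ge0$ by $$\mathcal C_k^{1,{\rm HD}}(T)=\frac{2\pi\lambda_k}{\mathcal A_k}\int_0^\infty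 e^{-T\sigma^2r^\alpha/P_k}\,\mathcal F_k(r)\prod_{t=1,2}\exp\Bigl(-2\pi\int_{r(P_t/P_k)^{1/\alpha}}^\infty\lambda^{\rm BS}_{k,t}(y)\,y\Bigl(1-\frac1{1+P_tTr^\alpha/(P_ky^\alpha)}\Bigr)dy\Bigr)dr,$$ $$\mathcal C_k^{2,{\rm HD}}(T)=\frac{2\pi\lambda_k}{\mathcal A_k}\int_0^\infty e^{-T\sigma^2r^\alpha/P_u}\,\mathcal F_k(r)\prod_{t=1,2}\exp\Bigl(-2\pi\int_0^\infty\lambda^{\rm User}_{k,t}(y)\,y\Bigl(1-\frac1{1+Tr^\alpha/y^\alpha}\Bigr)dy\Bigr)dr,$$ $$\mathcal F_k(r)=r\exp\bigl(-\pi\lambda_kr^2-\pi\lambda_{\bar k}r^2(P_{\bar k}/P_k)^{2/\alpha}\bigr).$$ -/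

import Mathlib

open MeasureTheory ProbabilityTheory
open scoped ENNReal NNReal

noncomputable section

namespace HetNet

/-! ### Poisson point processes in the plane -/

/-- The Euclidean plane. -/
abbrev Plane := EuclideanSpace ℝ (Fin 2)

/-- A labelled, at most countable configuration of points of the plane: the (possibly infinite)
number `c.1` of points, and the points `c.2 i`, of which only those with `i < c.1` are present. -/
abbrev Config := ℕ∞ × (ℕ → Plane)

/-- The number of points of the configuration in the set `B`. -/
def count (c : Config) (B : Set Plane) : ℝ≥0∞ :=
  ∑' i : ℕ, {j : ℕ | (j : ℕ∞) < c.1 ∧ c.2 j ∈ B}.indicator (fun _ => 1) i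

/-- `X` is a Poisson point process with intensity measure `Λ` under `μ`: the number of points in
a set of finite intensity is Poisson distributed, with the intensity of the set as its mean, and
the numbers of points in pairwise disjoint sets are independent. -/
structure IsPoisson {Ω : Type*} [MeasurableSpace Ω] (μ : Measure Ω) (X : Ω → Config)
    (Λ : Measure Plane) : Prop where
  measurable : Measurable X
  poisson : ∀ B : Set Plane, MeasurableSet B → Λ B ≠ ⊤ →
    μ.map (fun ω => count (X ω) B) =
      (poissonMeasure (Λ B).toNNReal).map (fun n : ℕ => (n : ℝ≥0∞))
  indep : ∀ (n : ℕ) (B : Fin n → Set Plane), (∀ i, MeasurableSet (B i)) →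
    (Pairwise fun i j => Disjoint (B i) (B j)) →
    iIndepFun (fun i ω => count (X ω) (B i)) μ

/-- The distance from the origin to the closest point of a configuration (`⊤` if it is empty). -/
def nearest (c : Config) : ℝ≥0∞ :=
  ⨅ i : ℕ, ⨅ _ : (i : ℕ∞) < c.1, ‖c.2 i‖ₑ

/-! ### Parameters and labels -/

/-- The parameters of a two-tier network. -/
structure Params where
  /-- densities of the base stations of the two tiers -/
  lam : Fin 2 → ℝ
  /-- density of the users -/
  lamU : ℝ
  /-- transmit powers of the base stations of the two tiers -/
  P : Fin 2 → ℝ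
  /-- transmit power of the users -/
  PU : ℝ
  /-- residual self-interference of the base stations of the two tiers -/
  RSI : Fin 2 → ℝ
  /-- residual self-interference of the users -/
  RSIU : ℝ
  /-- thermal noise power -/
  noise : ℝ
  /-- path loss exponent -/
  α : ℝ
  lam_pos : ∀ k, 0 < lam k
  lamU_pos : 0 < lamU
  P_pos : ∀ k, 0 < P k
  PU_pos : 0 < PU
  RSI_nonneg : ∀ k, 0 ≤ RSI k
  RSIU_nonneg : 0 ≤ RSIU
  noise_pos : 0 < noise
  two_lt_α : 2 < α

/-- The other tier. -/
def other (k : Fin 2) : Fin 2 := k.rev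

/-- Duplex modes: full-duplex and half-duplex. -/
inductive Mode
  | FD
  | HD
  deriving DecidableEq

instance : Fintype Mode := ⟨{.FD, .HD}, by intro x; cases x <;> simp⟩

/-- Kinds of transmitting nodes: base stations and users. -/
inductive Node
  | bs
  | user
  deriving DecidableEq

instance : Fintype Node := ⟨{.bs, .user}, by intro x; cases x <;> simp⟩

/-- Directions: downlink (the receiver is the typical user) and uplink (the receiver is the
tagged base station). -/
inductive Link
  | down
  | up
  deriving DecidableEq

instance : Fintype Link := ⟨{.down, .up}, by intro x; cases x <;> simp⟩

/-- The two orthogonal channels: channel 1 (downlink channel) and channel 2 (uplink channel). -/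
inductive Channel
  | one
  | two
  deriving DecidableEq

instance : Fintype Channel := ⟨{.one, .two}, by intro x; cases x <;> simp⟩

/-! ### Association of the typical user (at the origin) -/

/-- The average downlink power received from a base station of tier `k` at distance `d`. -/
def rxPower (p : Params) (k : Fin 2) (d : ℝ≥0∞) : ℝ≥0∞ :=
  ENNReal.ofReal (p.P k) * d ^ (-p.α)

section Association

variable {Ω : Type*} [MeasurableSpace Ω]

/-- The event that the typical user is associated with tier `k`: tier `k` provides the maximum
average downlink received power. -/
def assocEvent (p : Params) (Φ : Fin 2 → Ω → Config) (k : Fin 2) : Set Ω :=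
  {ω | ∀ t, rxPower p t (nearest (Φ t ω)) ≤ rxPower p k (nearest (Φ k ω))}

/-- The event that the typical user is associated with tier `k` and scheduled in mode `m`, for
the received power thresholds `γ`. -/
def userEvent (p : Params) (γ : Fin 2 → ℝ≥0∞) (Φ : Fin 2 → Ω → Config) (k : Fin 2) :
    Mode → Set Ω
  | .FD => assocEvent p Φ k ∩ {ω | γ k ≤ rxPower p k (nearest (Φ k ω))}
  | .HD => assocEvent p Φ k ∩ {ω | rxPower p k (nearest (Φ k ω)) < γ k}

/-- The probability that the typical user is associated with tier `k`. -/
def assocProb (p : Params) (μ : Measure Ω) (Φ : Fin 2 → Ω → Config) (k : Fin 2) : ℝ :=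
  μ.real (assocEvent p Φ k)

/-- The probability that the typical user is associated with tier `k` in mode `m`. -/
def modeProb (p : Params) (γ : Fin 2 → ℝ≥0∞) (μ : Measure Ω) (Φ : Fin 2 → Ω → Config)
    (k : Fin 2) (m : Mode) : ℝ :=
  μ.real (userEvent p γ Φ k m)

/-- The law of the distance between the typical user and its serving base station, given that
the user is associated with tier `k` in mode `m`. -/
def distLaw (p : Params) (γ : Fin 2 → ℝ≥0∞) (μ : Measure Ω) (Φ : Fin 2 → Ω → Config)
    (k : Fin 2) (m : Mode) : Measure ℝ :=
  (ProbabilityTheory.cond μ (userEvent p γ Φ k m)).map (fun ω => (nearest (Φ k ω)).toReal)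

/-- The density of the base stations of tier `t` that schedule a user in mode `m`. -/
def modeDensity (p : Params) (γ : Fin 2 → ℝ≥0∞) (μ : Measure Ω) (Φ : Fin 2 → Ω → Config)
    (t : Fin 2) (m : Mode) : ℝ≥0∞ :=
  ENNReal.ofReal (modeProb p γ μ Φ t m / assocProb p μ Φ t * p.lam t)

end Association

/-! ### Intensities of the interfering nodes

All intensities are conditional on the distance `r` between the typical user, of tier `k`, and
the tagged base station; `y` is the distance from the interfering node of tier `t` to the
receiver. Extended nonnegative reals are used, so that `a / 0 = ⊤` for `a > 0`. -/

/-- The largest distance at which a user of tier `t` is in full-duplex mode. -/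
def delta (p : Params) (γ : Fin 2 → ℝ≥0∞) (t : Fin 2) : ℝ≥0∞ :=
  (ENNReal.ofReal (p.P t) / γ t) ^ (1 / p.α)

/-- `P_t ^ (1 / α) / P_k ^ (1 / α)`. -/
def ratio (p : Params) (k t : Fin 2) : ℝ := (p.P t / p.P k) ^ (1 / p.α)

/-- Distance between an interfering base station and the handover point. -/
def zeta (p : Params) (k t : Fin 2) (r y : ℝ) : Link → ℝ≥0∞
  | .down => ENNReal.ofReal (r + y) / ENNReal.ofReal (max (ratio p t k - 1) 0)
  | .up => ENNReal.ofReal y / ENNReal.ofReal (max (ratio p t k - 1) 0)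

/-- `1 - exp (-x)`, with value `1` at `x = ⊤`. -/
def oneSubExpNeg (x : ℝ≥0∞) : ℝ≥0∞ := 1 - EReal.exp (-(x : EReal))

/-- The probability that an interfering base station with coverage radius `z` is active in
mode `m`. -/
def activeBS (p : Params) (γ : Fin 2 → ℝ≥0∞) (t : Fin 2) (z : ℝ≥0∞) : Mode → ℝ≥0∞
  | .FD => oneSubExpNeg (ENNReal.ofReal (p.lamU * Real.pi) * z ^ 2)
  | .HD => if z ≤ delta p γ t then 0
      else oneSubExpNeg (ENNReal.ofReal (p.lamU * Real.pi) * (z ^ 2 - delta p γ t ^ 2))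

/-- The thinning probability of the interfering users of tier `t`. -/
def activeUser (p : Params) (k t : Fin 2) (r y : ℝ) : Link → ℝ≥0∞
  | .down => ENNReal.ofReal
      (1 - Real.exp (-(Real.pi * (r + y) ^ 2 * p.lam t * ratio p k t ^ 2)))
  | .up => ENNReal.ofReal
      (1 - Real.exp (-(Real.pi * y ^ 2 * p.lam t * ratio p k t ^ 2)))

/-- The part of the circle of radius `y` around the receiver that can contain interfering base
stations of tier `t`. On the downlink there is none closer than `r (P_t / P_k) ^ (1 / α)`. On the
uplink, up to the distance `r (P_t / P_k) ^ (1 / α) + r`, a sector is free of them. -/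
def exclBS (p : Params) (k t : Fin 2) (r y : ℝ) : Link → ℝ≥0∞
  | .down => if r * ratio p k t ≤ y then 1 else 0
  | .up => if r * ratio p k t + r ≤ y then 1
      else ENNReal.ofReal (1 - (p.P t ^ (1 / p.α) /
        (p.P t ^ (1 / p.α) + p.P k ^ (1 / p.α))) ^ 2)

open Classical in
/-- Indicator of the distances `y` to the receiver that are possible for an interfering user of
tier `t` in mode `m`. -/
def exclUser (p : Params) (γ : Fin 2 → ℝ≥0∞) (k t : Fin 2) (r y : ℝ) : Link → Mode → ℝ≥0∞
  | .down, .FD => if ENNReal.ofReal (r * ratio p k t) ≤ ENNReal.ofReal y + delta p γ t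
      then 1 else 0
  | .down, .HD => if delta p γ t * ENNReal.ofReal (ratio p t k) ≤ ENNReal.ofReal (r + y)
      then 1 else 0
  | .up, .FD => if ENNReal.ofReal ((ratio p k t - 1) * r) ≤ ENNReal.ofReal y + delta p γ t
      then 1 else 0
  | .up, .HD => if ENNReal.ofReal (ratio p t k) * delta p γ t ≤ ENNReal.ofReal y
      then 1 else 0

/-- Labels of the point processes of interfering nodes: tier, kind of node, mode. -/
abbrev Idx := Fin 2 × Node × Mode

section Interference

variable {Ω : Type*} [MeasurableSpace Ω]

/-- The intensity function of the interfering nodes with label `(t, node, m)`, at distance `y` from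
the receiver, given the distance `r` between the typical user, of tier `k`, and its server. -/
def intensity (p : Params) (γ : Fin 2 → ℝ≥0∞) (μ : Measure Ω) (Φ : Fin 2 → Ω → Config)
    (k : Fin 2) (l : Link) (r y : ℝ) : Idx → ℝ≥0∞
  | (t, .bs, m) => modeDensity p γ μ Φ t m * activeBS p γ t (zeta p k t r y l) m *
      exclBS p k t r y l
  | (t, .user, m) => modeDensity p γ μ Φ t m * activeUser p k t r y l *
      exclUser p γ k t r y l m

/-- The corresponding intensity measure, with the receiver at the origin. -/
def intensityMeasure (p : Params) (γ : Fin 2 → ℝ≥0∞) (μ : Measure Ω)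
    (Φ : Fin 2 → Ω → Config) (k : Fin 2) (l : Link) (r : ℝ) (j : Idx) : Measure Plane :=
  (volume : Measure Plane).withDensity (fun x => intensity p γ μ Φ k l r ‖x‖ j)

/-- Everything that, besides the distance `r`, determines the SINR of a link: the fading of the
desired signal, the positions of the interfering nodes relative to the receiver, and the fading
of each interfering node. -/
abbrev Env := ℝ × (Idx → Config) × (Idx → ℕ → ℝ)

/-- The law `Q` of the environment of a link of the given direction, for a typical user of tier
`k` at distance `r` from its server: the interfering nodes form independent Poisson processes
with the above intensities, and all fading variables are exponential with mean one, independent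
of each other and of the positions. -/
def IsEnvLaw (p : Params) (γ : Fin 2 → ℝ≥0∞) (μ : Measure Ω) (Φ : Fin 2 → Ω → Config)
    (k : Fin 2) (l : Link) (r : ℝ) (Q : Measure Env) : Prop :=
  ∃ ν : Idx → Measure Config,
    (∀ j, IsProbabilityMeasure (ν j)) ∧
    (∀ j, IsPoisson (ν j) id (intensityMeasure p γ μ Φ k l r j)) ∧
    Q = (expMeasure 1).prod ((Measure.pi ν).prod
      (Measure.pi fun _ : Idx => Measure.infinitePi fun _ : ℕ => expMeasure 1))

end Interference

/-! ### SINR, coverage and spectral efficiency -/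

/-- The total power received at the origin from the nodes of the configuration `c`, which
transmit with power `P`, under the fading `h`. -/
def received (p : Params) (P : ℝ) (c : Config) (h : ℕ → ℝ) : ℝ≥0∞ :=
  ∑' i : ℕ, {j : ℕ | (j : ℕ∞) < c.1}.indicator
    (fun j => ENNReal.ofReal (P * h j) * ‖c.2 j‖ₑ ^ (-p.α)) i

/-- The transmit power of a node of tier `k`. -/
def txPower (p : Params) (k : Fin 2) : Node → ℝ
  | .bs => p.P k
  | .user => p.PU

/-- Whether nodes of a kind and mode transmit on a channel: full-duplex base stations and users
transmit on both channels, half-duplex base stations on channel 1, half-duplex users on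
channel 2. -/
def transmits : Channel → Node → Mode → Prop
  | _, _, .FD => True
  | .one, .bs, .HD => True
  | .one, .user, .HD => False
  | .two, .bs, .HD => False
  | .two, .user, .HD => True

open Classical in
/-- The cumulative interference on channel `i` from tier `t`. -/
def interference (p : Params) (i : Channel) (t : Fin 2) (e : Env) : ℝ≥0∞ :=
  ∑ n : Node, ∑ m : Mode, if transmits i n m
    then received p (txPower p t n) (e.2.1 (t, n, m)) (e.2.2 (t, n, m)) else 0

/-- The transmitter of the desired signal of a link. -/
def sender : Link → Node
  | .down => .bs
  | .up => .user

/-- The residual self-interference at the receiver of a link of a user of tier `k`. -/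
def selfInterference (p : Params) (k : Fin 2) : Link → Mode → ℝ
  | .down, .FD => p.RSIU
  | .up, .FD => p.RSI k
  | _, .HD => 0

/-- The SINR of the link in direction `l` on channel `i` of a typical user of tier `k` in mode
`m`, at distance `r` from its server. -/
def sinr (p : Params) (k : Fin 2) (m : Mode) (l : Link) (i : Channel) (r : ℝ) (e : Env) : ℝ :=
  (ENNReal.ofReal (txPower p k (sender l) * e.1 * r ^ (-p.α)) /
    (ENNReal.ofReal (selfInterference p k l m) + ∑ t, interference p i t e +
      ENNReal.ofReal p.noise)).toReal

section Performance

variable {Ω : Type*} [MeasurableSpace Ω]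

/-- The joint law of the distance to the server and of the environment of the link, for a typical
user of tier `k` in mode `m`; `κ k l r` is the law of the environment given the distance `r`. -/
def jointLaw (p : Params) (γ : Fin 2 → ℝ≥0∞) (μ : Measure Ω) (Φ : Fin 2 → Ω → Config)
    (κ : Fin 2 → Link → Kernel ℝ Env) (k : Fin 2) (m : Mode) (l : Link) : Measure (ℝ × Env) :=
  (distLaw p γ μ Φ k m).compProd (κ k l)

/-- The SINR distribution: the probability that the SINR exceeds the threshold `T`. -/
def coverage (p : Params) (γ : Fin 2 → ℝ≥0∞) (μ : Measure Ω) (Φ : Fin 2 → Ω → Config)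
    (κ : Fin 2 → Link → Kernel ℝ Env) (k : Fin 2) (m : Mode) (l : Link) (i : Channel)
    (T : ℝ) : ℝ :=
  (jointLaw p γ μ Φ κ k m l).real {z | T < sinr p k m l i z.1 z.2}

/-- The rate `log₂ (1 + SINR)`. -/
def rate (p : Params) (k : Fin 2) (m : Mode) (l : Link) (i : Channel) (z : ℝ × Env) : ℝ :=
  Real.logb 2 (1 + sinr p k m l i z.1 z.2)

/-- The spectral efficiency of a link of the typical user of tier `k` in mode `m`. -/
def linkSE (p : Params) (γ : Fin 2 → ℝ≥0∞) (μ : Measure Ω) (Φ : Fin 2 → Ω → Config)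
    (κ : Fin 2 → Link → Kernel ℝ Env) (k : Fin 2) (m : Mode) (l : Link) (i : Channel) : ℝ :=
  1 / 2 * ∫ z, rate p k m l i z ∂(jointLaw p γ μ Φ κ k m l)

/-- The direction in which half-duplex users communicate on a channel. -/
def hdLink : Channel → Link
  | .one => .down
  | .two => .up

/-- The spectral efficiency of the typical user. -/
def spectralEfficiency (p : Params) (γ : Fin 2 → ℝ≥0∞) (μ : Measure Ω)
    (Φ : Fin 2 → Ω → Config) (κ : Fin 2 → Link → Kernel ℝ Env) : ℝ :=
  ∑ i : Channel, ∑ k : Fin 2,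
    (modeProb p γ μ Φ k .FD *
        (linkSE p γ μ Φ κ k .FD .down i + linkSE p γ μ Φ κ k .FD .up i) +
      modeProb p γ μ Φ k .HD * linkSE p γ μ Φ κ k .HD (hdLink i) i)

end Performance

/-- The thresholds of the pure half-duplex network. -/
def halfDuplex : Fin 2 → ℝ≥0∞ := fun _ => ⊤

/-! ### Closed forms for the pure half-duplex network -/

/-- `λ_k P_k ^ (2/α) / (λ_k P_k ^ (2/α) + λ_k' P_k' ^ (2/α))`, where `k'` is the other tier. -/
def tierProb (p : Params) (k : Fin 2) : ℝ :=
  p.lam k * p.P k ^ (2 / p.α) /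
    (p.lam k * p.P k ^ (2 / p.α) + p.lam (other k) * p.P (other k) ^ (2 / p.α))

/-- `r exp (-π λ_k r² - π λ_k' (r (P_k' / P_k) ^ (1/α))²)`. -/
def distFactor (p : Params) (k : Fin 2) (r : ℝ) : ℝ :=
  r * Real.exp (-(Real.pi * p.lam k * r ^ 2) -
    Real.pi * p.lam (other k) * (r * (p.P (other k) / p.P k) ^ (1 / p.α)) ^ 2)

/-- The Laplace transform `1 / (1 + s)` of the exponential law with mean one. -/
def laplaceExp (s : ℝ) : ℝ := 1 / (1 + s)

/-- Intensity of the half-duplex base stations of tier `t`, downlink. -/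
def hdIntensityBS (p : Params) (k t : Fin 2) (r y : ℝ) : ℝ :=
  if p.P k ≤ p.P t then p.lam t
  else p.lam t * (1 - Real.exp (-(p.lamU * Real.pi *
    ((r + y) / ((p.P k / p.P t) ^ (1 / p.α) - 1)) ^ 2)))

/-- Laplace transform of the interference from the half-duplex base stations of tier `t`. -/
def hdLaplaceBS (p : Params) (k t : Fin 2) (r T : ℝ) : ℝ :=
  Real.exp (-(2 * Real.pi * ∫ y in Set.Ioi (r * (p.P t / p.P k) ^ (1 / p.α)),
    hdIntensityBS p k t r y * y * (1 - laplaceExp (p.P t * T * r ^ p.α / (p.P k * y ^ p.α)))))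

/-- Intensity of the half-duplex users of tier `t`, uplink. -/
def hdIntensityUser (p : Params) (k t : Fin 2) (y : ℝ) : ℝ :=
  p.lam t * (1 - Real.exp (-(Real.pi * y ^ 2 * p.lam t * (p.P t / p.P k) ^ (2 / p.α))))

/-- Laplace transform of the interference from the half-duplex users of tier `t`. -/
def hdLaplaceUser (p : Params) (k t : Fin 2) (r T : ℝ) : ℝ :=
  Real.exp (-(2 * Real.pi * ∫ y in Set.Ioi (0 : ℝ),
    hdIntensityUser p k t y * y * (1 - laplaceExp (T * r ^ p.α / y ^ p.α))))

/-- Closed form of the downlink SINR distribution in the half-duplex network. -/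
def hdCoverageDown (p : Params) (k : Fin 2) (T : ℝ) : ℝ :=
  2 * Real.pi * p.lam k / tierProb p k * ∫ r in Set.Ioi (0 : ℝ),
    Real.exp (-(T / (p.P k * r ^ (-p.α) / p.noise))) * distFactor p k r *
      (hdLaplaceBS p k k r T * hdLaplaceBS p k (other k) r T)

/-- Closed form of the uplink SINR distribution in the half-duplex network. -/
def hdCoverageUp (p : Params) (k : Fin 2) (T : ℝ) : ℝ :=
  2 * Real.pi * p.lam k / tierProb p k * ∫ r in Set.Ioi (0 : ℝ),
    Real.exp (-(T / (p.PU * r ^ (-p.α) / p.noise))) * distFactor p k r *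
      (hdLaplaceUser p k k r T * hdLaplaceUser p k (other k) r T)

end HetNet

end

open HetNet

/-! ### The exponential `exp (-x)` on `[0, ∞]` -/

noncomputable section
namespace HetNet

/-! Everything rests on the exponential law of the fading. Given the distance `r` and the
interference `I`, the SINR exceeds `T` exactly when the fading of the desired signal exceeds `s (I +
σ²)`, where `s = T r^α / P`. This has probability `exp (-s σ²) exp (-s I)`, so averaging over the
interferers leaves the Laplace transform of `I` at `s` (`expMeasure_lt_sinr`, `envLaw_lt_sinr`).

That transform comes from the Laplace functional of a Poisson process, `E exp (-∑ f) = exp (-∫ (1 -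
exp (-f)) dΛ)`. It follows from the counts alone: the Poisson generating function on one set,
independence over the level sets of a simple function, then monotone limits
(`IsPoisson.lintegral_expNeg`). Independent marks are averaged out point by point, and independent
families multiply (`lintegral_expNeg_sum_markedSum`). With exponential marks the inner average is `1
/ (1 + c)`, and polar coordinates produce the radial integrals (`laplaceExponent_radial`).

The distances are governed by void probabilities: the nearest point of a tier is beyond `a` with
probability `exp (-π λ a²)`. Independence of the tiers then gives the joint law of association and
serving distance (`measure_assocEvent_inter`), hence `tierProb` and the density `distFactor`. With
infinite thresholds the full-duplex event is null, since the received power is almost surely finite.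
Full-duplex intensities vanish, and on each channel only the half-duplex nodes transmitting there
contribute (`laplaceExponent_nodePower`).

Finally, `log₂ (1 + x)` is the integral of `1 / ((1 + t) ln 2)` over `[0, x]`, so the mean rate is
an integral of the SINR tail (`lintegral_logb_one_add`). Convergence is due to the noise alone,
which forces the tail to be `O(T^(-1/α))` (`exists_jointLaw_lt_sinr_le`). -/

/-- `exp (-x)` on the extended nonnegative reals. -/
def expNeg (x : ℝ≥0∞) : ℝ≥0∞ := EReal.exp (-(x : EReal))

@[simp] lemma expNeg_zero : expNeg 0 = 1 := by simp [expNeg]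

@[simp] lemma expNeg_top : expNeg ⊤ = 0 := by simp [expNeg]

lemma expNeg_ofReal {a : ℝ} (ha : 0 ≤ a) :
    expNeg (ENNReal.ofReal a) = ENNReal.ofReal (Real.exp (-a)) := by
  rw [expNeg, EReal.coe_ennreal_ofReal, max_eq_left ha, ← EReal.coe_neg, EReal.exp_coe]

lemma expNeg_of_ne_top {x : ℝ≥0∞} (hx : x ≠ ⊤) :
    expNeg x = ENNReal.ofReal (Real.exp (-x.toReal)) := by
  rw [← expNeg_ofReal ENNReal.toReal_nonneg, ENNReal.ofReal_toReal hx]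

lemma expNeg_add (x y : ℝ≥0∞) : expNeg (x + y) = expNeg x * expNeg y := by
  rw [expNeg, EReal.coe_ennreal_add, EReal.neg_add, sub_eq_add_neg, EReal.exp_add]; rfl
  · left; exact EReal.coe_ennreal_ne_bot _
  · right; exact EReal.coe_ennreal_ne_bot _

lemma expNeg_sum {ι : Type*} (s : Finset ι) (f : ι → ℝ≥0∞) :
    expNeg (∑ i ∈ s, f i) = ∏ i ∈ s, expNeg (f i) := by
  classical
  induction s using Finset.induction_on with
  | empty => simp
  | insert a s ha ih => rw [Finset.sum_insert ha, Finset.prod_insert ha, expNeg_add, ih]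

lemma expNeg_strictAnti : StrictAnti expNeg := fun x y h => by
  rw [expNeg, expNeg, EReal.exp_lt_exp_iff, EReal.neg_lt_neg_iff]
  exact_mod_cast h

lemma expNeg_antitone : Antitone expNeg := expNeg_strictAnti.antitone

lemma continuous_expNeg : Continuous expNeg :=
  ENNReal.continuous_exp.comp (continuous_neg.comp continuous_coe_ennreal_ereal)

@[fun_prop] lemma measurable_expNeg : Measurable expNeg := continuous_expNeg.measurable

lemma expNeg_le_one (x : ℝ≥0∞) : expNeg x ≤ 1 :=
  expNeg_zero ▸ expNeg_antitone zero_le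

lemma expNeg_ne_top (x : ℝ≥0∞) : expNeg x ≠ ⊤ :=
  ne_top_of_le_ne_top ENNReal.one_ne_top (expNeg_le_one x)

lemma oneSubExpNeg_eq (x : ℝ≥0∞) : oneSubExpNeg x = 1 - expNeg x := rfl

/-- `-log x` for `x ≤ 1`. -/
def negLog (x : ℝ≥0∞) : ℝ≥0∞ := (-ENNReal.log x).toENNReal

@[fun_prop] lemma measurable_negLog : Measurable negLog :=
  measurable_ereal_toENNReal.comp
    (continuous_neg.measurable.comp ENNReal.continuous_log.measurable)

/-- This lets a mean over marks, a number in `[0, 1]`, be written as the exponential of minus a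
function of the position. The value `x = 0` is covered by `negLog 0 = ⊤`; above one the truncation
in `negLog` would lose information. -/
lemma expNeg_negLog {x : ℝ≥0∞} (hx : x ≤ 1) : expNeg (negLog x) = x := by
  rw [expNeg, negLog, EReal.coe_toENNReal, neg_neg, ENNReal.exp_log]
  rw [EReal.neg_nonneg]
  exact ENNReal.log_le_zero_iff.2 hx

/-! ### The Laplace functional of a Poisson process -/

/-- The random counting measure attached to a configuration. -/
def pointMeasure (c : Config) : Measure Plane :=
  Measure.sum fun i : ℕ => {j : ℕ | (j : ℕ∞) < c.1}.indicator (fun j => Measure.dirac (c.2 j)) i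

lemma lintegral_pointMeasure (c : Config) {f : Plane → ℝ≥0∞} (hf : Measurable f) :
    ∫⁻ x, f x ∂(pointMeasure c) =
      ∑' i : ℕ, {j : ℕ | (j : ℕ∞) < c.1}.indicator (fun j => f (c.2 j)) i := by
  rw [pointMeasure, lintegral_sum_measure]
  refine tsum_congr fun i => ?_
  by_cases hi : (i : ℕ∞) < c.1
  · simp [Set.indicator, hi, lintegral_dirac' _ hf]
  · simp [Set.indicator, hi]

lemma pointMeasure_apply (c : Config) {B : Set Plane} (hB : MeasurableSet B) :
    pointMeasure c B = count c B := by
  rw [pointMeasure, Measure.sum_apply _ hB, count]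
  refine tsum_congr fun i => ?_
  by_cases hi : (i : ℕ∞) < c.1
  · by_cases hb : c.2 i ∈ B <;> simp [Set.indicator, hi, hb, Measure.dirac_apply' _ hB]
  · simp [Set.indicator, hi]

/-- The number of points varies with `b`, but it only enters through the events that the `i`-th
point is present, which are measurable because `ℕ∞` is discrete. -/
lemma measurable_tsum_points {β : Type*} [MeasurableSpace β] {C : β → Config}
    (hC : Measurable C) {G : ℕ → β → ℝ≥0∞} (hG : ∀ i, Measurable (G i)) :
    Measurable fun b => ∑' i : ℕ, {j : ℕ | (j : ℕ∞) < (C b).1}.indicator (fun j => G j b) i := by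
  refine Measurable.tsum fun i => ?_
  have h : MeasurableSet {b | (i : ℕ∞) < (C b).1} :=
    (measurable_fst.comp hC) (MeasurableSet.of_discrete (s := {n : ℕ∞ | (i : ℕ∞) < n}))
  have := (hG i).indicator h
  exact this

lemma measurable_count {B : Set Plane} (hB : MeasurableSet B) :
    Measurable fun c : Config => count c B := by
  have h : (fun c : Config => count c B) = fun c : Config => ∑' i : ℕ,
      {j : ℕ | (j : ℕ∞) < c.1}.indicator (fun j => B.indicator (fun _ => 1) (c.2 j)) i := by
    funext c
    refine tsum_congr fun i => ?_
    by_cases hi : (i : ℕ∞) < c.1 <;> by_cases hb : c.2 i ∈ B <;> simp [Set.indicator, hi, hb]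
  rw [h]
  exact measurable_tsum_points measurable_id fun i =>
    (measurable_const.indicator hB).comp ((measurable_pi_apply i).comp measurable_snd)

lemma measurable_lintegral_pointMeasure {f : Plane → ℝ≥0∞} (hf : Measurable f) :
    Measurable fun c : Config => ∫⁻ x, f x ∂(pointMeasure c) := by
  simp_rw [lintegral_pointMeasure _ hf]
  exact measurable_tsum_points measurable_id fun i =>
    hf.comp ((measurable_pi_apply i).comp measurable_snd)

/-- The generating function `E q^N = exp (-(1 - q) m)` at `q = exp (-a)`, from the exponential
series. Allowing `a = ⊤`, that is `q = 0`, makes void probabilities a special case. -/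
lemma lintegral_expNeg_poissonMeasure (m : ℝ≥0) (a : ℝ≥0∞) :
    ∫⁻ n : ℕ, expNeg (a * n) ∂(poissonMeasure m) = expNeg ((1 - expNeg a) * m) := by
  obtain ⟨q, hq⟩ : ∃ q : ℝ≥0, expNeg a = q := ⟨_, (ENNReal.coe_toNNReal (expNeg_ne_top a)).symm⟩
  have hq1 : q ≤ 1 := by
    have := expNeg_le_one a; rw [hq] at this; exact_mod_cast this
  have hpow : ∀ n : ℕ, expNeg (a * n) = ENNReal.ofReal ((q : ℝ) ^ n) := by
    intro n
    have : a * n = ∑ _i ∈ Finset.range n, a := by simp [mul_comm]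
    rw [this, expNeg_sum, Finset.prod_const, Finset.card_range, hq,
      ENNReal.ofReal_pow q.coe_nonneg, ENNReal.ofReal_coe_nnreal]
  have hm : (1 - expNeg a) * m = ENNReal.ofReal ((1 - q) * m) := by
    rw [hq, ENNReal.ofReal_mul (sub_nonneg.2 (by exact_mod_cast hq1)),
      ENNReal.ofReal_sub _ q.coe_nonneg]
    simp
  rw [hm, expNeg_ofReal (mul_nonneg (sub_nonneg.2 (by exact_mod_cast hq1)) m.coe_nonneg),
    poissonMeasure, lintegral_sum_measure]
  have hs : HasSum (fun n : ℕ => Real.exp (-m) * m ^ n / n.factorial * (q : ℝ) ^ n)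
      (Real.exp (-((1 - q) * m))) := by
    have := (NormedSpace.expSeries_div_hasSum_exp ((m : ℝ) * q)).mul_left (Real.exp (-m))
    rw [← Real.exp_eq_exp_ℝ, ← Real.exp_add] at this
    have e1 : ∀ n : ℕ, Real.exp (-m) * m ^ n / n.factorial * (q : ℝ) ^ n =
        Real.exp (-m) * (((m : ℝ) * q) ^ n / n.factorial) := fun n => by rw [mul_pow]; ring
    have e2 : -((1 - (q : ℝ)) * m) = -m + m * q := by ring
    simp_rw [e1, e2]
    exact this
  rw [← hs.tsum_eq, ENNReal.ofReal_tsum_of_nonneg (fun n => by positivity) hs.summable]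
  refine tsum_congr fun n => ?_
  rw [lintegral_smul_measure, lintegral_dirac, hpow, smul_eq_mul,
    ← ENNReal.ofReal_mul (by positivity)]

variable {Ω : Type*} [MeasurableSpace Ω] {μ : Measure Ω} {X : Ω → Config} {Λ : Measure Plane}

lemma IsPoisson.lintegral_expNeg_count (hX : IsPoisson μ X Λ) {B : Set Plane}
    (hB : MeasurableSet B) (hΛ : Λ B ≠ ⊤) (a : ℝ≥0∞) :
    ∫⁻ ω, expNeg (a * count (X ω) B) ∂μ = expNeg ((1 - expNeg a) * Λ B) := by
  have hm : Measurable fun x : ℝ≥0∞ => expNeg (a * x) :=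
    measurable_expNeg.comp (measurable_const.mul measurable_id)
  have hc : Measurable fun ω => count (X ω) B := (measurable_count hB).comp hX.measurable
  rw [← lintegral_map (f := fun x => expNeg (a * x)) hm hc, hX.poisson B hB hΛ,
    lintegral_map hm .of_discrete, lintegral_expNeg_poissonMeasure, ENNReal.coe_toNNReal hΛ]

/-- Independence of the empty family already says that the whole space has measure one, the empty
product. -/
lemma IsPoisson.isProbabilityMeasure (hX : IsPoisson μ X Λ) : IsProbabilityMeasure μ :=
  (hX.indep 0 (fun _ => ∅) (fun _ => .empty) (fun i => i.elim0)).isProbabilityMeasure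

/-- The level sets are disjoint, so their counts are independent and the expectation factors into
one Poisson generating function per value. The level set of zero may have infinite intensity, since
its factor is one on both sides. -/
lemma IsPoisson.lintegral_expNeg_simpleFunc (hX : IsPoisson μ X Λ) (f : SimpleFunc Plane ℝ≥0∞)
    (hf : ∀ y, y ≠ 0 → Λ (f ⁻¹' {y}) ≠ ⊤) :
    ∫⁻ ω, expNeg (∫⁻ x, f x ∂(pointMeasure (X ω))) ∂μ =
      expNeg (∫⁻ x, (1 - expNeg (f x)) ∂Λ) := by
  have hprob := hX.isProbabilityMeasure
  set s := f.range
  let e := s.equivFin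
  have hind := hX.indep s.card (fun i => f ⁻¹' {(e.symm i : ℝ≥0∞)})
    (fun i => f.measurableSet_fiber _) (by
      intro i j hij
      refine Set.disjoint_left.2 fun x hx hx' => hij ?_
      exact e.symm.injective (Subtype.ext (hx.symm.trans hx')))
  have hind' := hind.comp (g := fun i z => expNeg ((e.symm i : ℝ≥0∞) * z))
    (fun i => measurable_expNeg.comp (measurable_const.mul measurable_id))
  have hfib : ∀ i, Measurable fun ω => count (X ω) (f ⁻¹' {(e.symm i : ℝ≥0∞)}) := fun i =>
    (measurable_count (f.measurableSet_fiber _)).comp hX.measurable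
  have hL : ∀ ω, expNeg (∫⁻ x, f x ∂(pointMeasure (X ω))) =
      ∏ i : Fin s.card, expNeg ((e.symm i : ℝ≥0∞) *
        count (X ω) (f ⁻¹' {(e.symm i : ℝ≥0∞)})) := by
    intro ω
    rw [SimpleFunc.lintegral_eq_lintegral, SimpleFunc.lintegral, expNeg_sum,
      ← Finset.prod_coe_sort, ← e.symm.prod_comp]
    refine Finset.prod_congr rfl fun i _ => ?_
    rw [pointMeasure_apply _ (f.measurableSet_fiber _)]
  have hR : ∫⁻ x, (1 - expNeg (f x)) ∂Λ =
      ∑ i : Fin s.card, (1 - expNeg (e.symm i : ℝ≥0∞)) * Λ (f ⁻¹' {(e.symm i : ℝ≥0∞)}) := by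
    have h1 : ∀ x, 1 - expNeg (f x) = (f.map fun y => 1 - expNeg y) x := fun x => rfl
    simp_rw [h1]
    rw [SimpleFunc.lintegral_eq_lintegral, SimpleFunc.map_lintegral,
      ← Finset.sum_coe_sort, ← e.symm.sum_comp]
  simp_rw [hL]
  have := lintegral_prod_eq_prod_lintegral_of_indepFun Finset.univ _ hind'
    (fun i => (measurable_expNeg.comp (measurable_const.mul measurable_id)).comp (hfib i))
  simp only [Function.comp_apply] at this
  rw [this, hR, expNeg_sum]
  refine Finset.prod_congr rfl fun i _ => ?_
  by_cases h0 : (e.symm i : ℝ≥0∞) = 0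
  · simp [h0]
  · exact hX.lintegral_expNeg_count (f.measurableSet_fiber _) (hf _ h0) _

/-- Cutting the usual approximations down to sets of finite intensity exhausting the plane keeps
them increasing to `f` and makes every nonzero level set finite. -/
lemma exists_simpleFunc_seq [SigmaFinite Λ] {f : Plane → ℝ≥0∞} (hf : Measurable f) :
    ∃ g : ℕ → SimpleFunc Plane ℝ≥0∞, (∀ n y, y ≠ 0 → Λ (g n ⁻¹' {y}) ≠ ⊤) ∧
      Monotone (fun n x => g n x) ∧ ∀ x, ⨆ n, g n x = f x := by
  refine ⟨fun n => (SimpleFunc.eapprox f n).restrict (spanningSets Λ n), ?_, ?_, ?_⟩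
  · intro n y hy
    refine ne_top_of_le_ne_top (measure_spanningSets_lt_top Λ n).ne (measure_mono ?_)
    intro x hx
    by_contra hx'
    rw [Set.mem_preimage, SimpleFunc.restrict_apply _ (measurableSet_spanningSets Λ n),
      Set.indicator_of_notMem hx'] at hx
    exact hy hx.symm
  · intro m n hmn x
    simp only [SimpleFunc.restrict_apply _ (measurableSet_spanningSets Λ _)]
    refine (Set.indicator_le_indicator (SimpleFunc.monotone_eapprox f hmn x)).trans
      (Set.indicator_le_indicator_of_subset (monotone_spanningSets Λ hmn)
        (fun _ => zero_le) x)
  · intro x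
    rw [← SimpleFunc.iSup_eapprox_apply hf x]
    obtain ⟨N, hN⟩ : ∃ N, x ∈ spanningSets Λ N := by
      have : x ∈ ⋃ n, spanningSets Λ n := by rw [iUnion_spanningSets]; trivial
      exact Set.mem_iUnion.1 this
    refine le_antisymm (iSup_mono fun n => ?_) (iSup_le fun n => ?_)
    · rw [SimpleFunc.restrict_apply _ (measurableSet_spanningSets Λ n)]
      exact Set.indicator_le_self _ _ _
    · refine le_trans ?_ (le_iSup _ (max n N))
      rw [SimpleFunc.restrict_apply _ (measurableSet_spanningSets Λ _),
        Set.indicator_of_mem (monotone_spanningSets Λ (le_max_right n N) hN)]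
      exact SimpleFunc.monotone_eapprox f (le_max_left n N) x

/-- Both sides pass to the limit along increasing simple functions: the left is dominated by one,
and on the right `1 - exp (-f)` increases with `f`. -/
theorem IsPoisson.lintegral_expNeg [SigmaFinite Λ] (hX : IsPoisson μ X Λ) {f : Plane → ℝ≥0∞}
    (hf : Measurable f) :
    ∫⁻ ω, expNeg (∫⁻ x, f x ∂(pointMeasure (X ω))) ∂μ =
      expNeg (∫⁻ x, (1 - expNeg (f x)) ∂Λ) := by
  have hprob := hX.isProbabilityMeasure
  obtain ⟨g, hgfin, hgmono, hgsup⟩ := exists_simpleFunc_seq (Λ := Λ) hf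
  have hgt : ∀ x, Filter.Tendsto (fun n => g n x) Filter.atTop (nhds (f x)) := fun x => by
    rw [← hgsup x]; exact tendsto_atTop_iSup fun m n h => hgmono h x
  have hlim : ∀ ν : Measure Plane, Filter.Tendsto (fun n => ∫⁻ x, g n x ∂ν) Filter.atTop
      (nhds (∫⁻ x, f x ∂ν)) := fun ν =>
    lintegral_tendsto_of_tendsto_of_monotone (fun n => (g n).measurable.aemeasurable)
      (.of_forall fun x m n h => hgmono h x) (.of_forall hgt)
  have hleft : Filter.Tendsto (fun n => ∫⁻ ω, expNeg (∫⁻ x, g n x ∂(pointMeasure (X ω))) ∂μ)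
      Filter.atTop (nhds (∫⁻ ω, expNeg (∫⁻ x, f x ∂(pointMeasure (X ω))) ∂μ)) := by
    refine tendsto_lintegral_of_dominated_convergence (fun _ => 1) (fun n => ?_) (fun n => ?_) ?_ ?_
    · exact measurable_expNeg.comp
        ((measurable_lintegral_pointMeasure (g n).measurable).comp hX.measurable)
    · exact .of_forall fun ω => expNeg_le_one _
    · simp
    · exact .of_forall fun ω => (continuous_expNeg.tendsto _).comp (hlim _)
  have hright : Filter.Tendsto (fun n => expNeg (∫⁻ x, (1 - expNeg (g n x)) ∂Λ))
      Filter.atTop (nhds (expNeg (∫⁻ x, (1 - expNeg (f x)) ∂Λ))) := by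
    refine (continuous_expNeg.tendsto _).comp ?_
    refine lintegral_tendsto_of_tendsto_of_monotone (fun n => ?_) ?_ ?_
    · exact (measurable_const.sub (measurable_expNeg.comp (g n).measurable)).aemeasurable
    · exact .of_forall fun x m n h => tsub_le_tsub_left (expNeg_antitone (hgmono h x)) 1
    · exact .of_forall fun x => ENNReal.Tendsto.sub tendsto_const_nhds
        ((continuous_expNeg.tendsto _).comp (hgt x)) (.inl ENNReal.one_ne_top)
  refine tendsto_nhds_unique hleft ?_
  simp_rw [hX.lintegral_expNeg_simpleFunc (g _) (hgfin _)]
  exact hright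

end HetNet
end

noncomputable section
namespace HetNet

/-! ### Independent marks -/

section Marks

variable {ρ : Measure ℝ} [IsProbabilityMeasure ρ]

lemma lintegral_le_one_of_expNeg {α : Type*} [MeasurableSpace α] {ν : Measure α}
    [IsProbabilityMeasure ν] (g : α → ℝ≥0∞) : ∫⁻ x, expNeg (g x) ∂ν ≤ 1 := by
  calc ∫⁻ x, expNeg (g x) ∂ν ≤ ∫⁻ _, 1 ∂ν := lintegral_mono fun x => expNeg_le_one _
    _ = 1 := by simp

/-- Finite partial sums factor by independence of the coordinates; dominated convergence handles the
limit. Writing the product of means as the exponential of a sum of `negLog` avoids infinite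
products. -/
lemma lintegral_expNeg_tsum_infinitePi {G : ℕ → ℝ → ℝ≥0∞} (hG : ∀ i, Measurable (G i)) :
    ∫⁻ h, expNeg (∑' i, G i (h i)) ∂(Measure.infinitePi fun _ : ℕ => ρ) =
      expNeg (∑' i, negLog (∫⁻ t, expNeg (G i t) ∂ρ)) := by
  have hind := iIndepFun_infinitePi (P := fun _ : ℕ => ρ) (X := fun i t => expNeg (G i t))
    (fun i => by have := hG i; fun_prop)
  have hfin : ∀ n, ∫⁻ h, expNeg (∑ i ∈ Finset.range n, G i (h i))
      ∂(Measure.infinitePi fun _ : ℕ => ρ) =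
      expNeg (∑ i ∈ Finset.range n, negLog (∫⁻ t, expNeg (G i t) ∂ρ)) := by
    intro n
    simp_rw [expNeg_sum]
    rw [lintegral_prod_eq_prod_lintegral_of_indepFun _ _ hind
      (fun i => measurable_expNeg.comp ((hG i).comp (measurable_pi_apply i)))]
    refine Finset.prod_congr rfl fun i _ => ?_
    rw [expNeg_negLog (lintegral_le_one_of_expNeg _)]
    exact (measurePreserving_eval_infinitePi (fun _ : ℕ => ρ) i).lintegral_comp
      (measurable_expNeg.comp (hG i))
  refine tendsto_nhds_unique (f := fun n => ∫⁻ h, expNeg (∑ i ∈ Finset.range n, G i (h i))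
      ∂(Measure.infinitePi fun _ : ℕ => ρ)) (l := Filter.atTop) ?_ ?_
  · refine tendsto_lintegral_of_dominated_convergence (fun _ => 1) (fun n => ?_) (fun n => ?_) ?_ ?_
    · exact measurable_expNeg.comp (Finset.measurable_fun_sum _ fun i _ =>
        (hG i).comp (measurable_pi_apply i))
    · exact .of_forall fun ω => expNeg_le_one _
    · simp
    · exact .of_forall fun ω => (continuous_expNeg.tendsto _).comp
        (ENNReal.tendsto_nat_tsum _)
  · simp_rw [hfin]
    exact (continuous_expNeg.tendsto _).comp (ENNReal.tendsto_nat_tsum _)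

/-- The sum of `F` over the marked points of a configuration. -/
def markedSum (F : Plane × ℝ → ℝ≥0∞) (c : Config) (h : ℕ → ℝ) : ℝ≥0∞ :=
  ∑' i : ℕ, {j : ℕ | (j : ℕ∞) < c.1}.indicator (fun j => F (c.2 j, h j)) i

lemma measurable_markedSum {F : Plane × ℝ → ℝ≥0∞} (hF : Measurable F) {β : Type*}
    [MeasurableSpace β] {C : β → Config} (hC : Measurable C) {H : β → ℕ → ℝ}
    (hH : Measurable H) : Measurable fun b => markedSum F (C b) (H b) :=
  measurable_tsum_points hC fun i => hF.comp
    (((measurable_pi_apply i).comp (measurable_snd.comp hC)).prodMk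
      ((measurable_pi_apply i).comp hH))

/-- With the positions frozen, averaging over the marks leaves an unmarked sum over the points, to
which the Laplace functional applies. Absent indices contribute `negLog 1 = 0`. -/
lemma lintegral_expNeg_markedSum_marks {F : Plane × ℝ → ℝ≥0∞} (hF : Measurable F)
    (c : Config) :
    ∫⁻ h, expNeg (markedSum F c h) ∂(Measure.infinitePi fun _ : ℕ => ρ) =
      expNeg (∫⁻ x, negLog (∫⁻ t, expNeg (F (x, t)) ∂ρ) ∂(pointMeasure c)) := by
  have h1 : ∀ h : ℕ → ℝ, markedSum F c h =
      ∑' i, (fun t => {j : ℕ | (j : ℕ∞) < c.1}.indicator (fun j => F (c.2 j, t)) i) (h i) := by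
    intro h
    refine tsum_congr fun i => ?_
    by_cases hi : (i : ℕ∞) < c.1 <;> simp [Set.indicator, hi]
  simp_rw [h1]
  rw [lintegral_expNeg_tsum_infinitePi
    (G := fun i t => {j : ℕ | (j : ℕ∞) < c.1}.indicator (fun j => F (c.2 j, t)) i),
    lintegral_pointMeasure]
  · congr 1
    refine tsum_congr fun i => ?_
    by_cases hi : (i : ℕ∞) < c.1
    · simp [Set.indicator, hi]
    · simp [Set.indicator, hi, negLog]
  · exact measurable_negLog.comp (Measurable.lintegral_prod_right' (measurable_expNeg.comp hF))
  · intro i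
    by_cases hi : (i : ℕ∞) < c.1
    · simp only [Set.indicator, Set.mem_ofPred_eq, hi, if_true]
      exact hF.comp measurable_prodMk_left
    · simp [Set.indicator, hi]

/-- The Laplace functional of an independently marked Poisson process. -/
theorem IsPoisson.lintegral_expNeg_markedSum {Λ : Measure Plane} [SigmaFinite Λ]
    {ν : Measure Config} (hν : IsPoisson ν id Λ) {F : Plane × ℝ → ℝ≥0∞} (hF : Measurable F) :
    ∫⁻ c, ∫⁻ h, expNeg (markedSum F c h) ∂(Measure.infinitePi fun _ : ℕ => ρ) ∂ν =
      expNeg (∫⁻ x, (1 - ∫⁻ t, expNeg (F (x, t)) ∂ρ) ∂Λ) := by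
  simp_rw [lintegral_expNeg_markedSum_marks hF]
  have := hν.lintegral_expNeg (f := fun x => negLog (∫⁻ t, expNeg (F (x, t)) ∂ρ))
    (measurable_negLog.comp (Measurable.lintegral_prod_right' (measurable_expNeg.comp hF)))
  simp only [id] at this
  rw [this]
  simp_rw [expNeg_negLog (lintegral_le_one_of_expNeg _)]

lemma lintegral_fintype_prod {ι : Type*} [Fintype ι] {E : ι → Type*}
    [∀ i, MeasurableSpace (E i)] (ν : ∀ i, Measure (E i)) [∀ i, IsProbabilityMeasure (ν i)]
    {f : ∀ i, E i → ℝ≥0∞} (hf : ∀ i, Measurable (f i)) :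
    ∫⁻ x, ∏ i, f i (x i) ∂(Measure.pi ν) = ∏ i, ∫⁻ y, f i y ∂(ν i) := by
  have hind := iIndepFun_pi (μ := ν) (X := f) (fun i => (hf i).aemeasurable)
  rw [lintegral_prod_eq_prod_lintegral_of_indepFun Finset.univ _ hind
    (fun i => (hf i).comp (measurable_pi_apply i))]
  refine Finset.prod_congr rfl fun i _ => ?_
  exact (measurePreserving_eval ν i).lintegral_comp (hf i)

/-- The Laplace functional of a family of independent, independently marked Poisson processes. -/
theorem lintegral_expNeg_sum_markedSum {ι : Type*} [Fintype ι] {Λ : ι → Measure Plane}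
    [∀ j, SigmaFinite (Λ j)] {ν : ι → Measure Config} [∀ j, IsProbabilityMeasure (ν j)]
    (hν : ∀ j, IsPoisson (ν j) id (Λ j)) {F : ι → Plane × ℝ → ℝ≥0∞}
    (hF : ∀ j, Measurable (F j)) :
    ∫⁻ z, expNeg (∑ j, markedSum (F j) (z.1 j) (z.2 j)) ∂((Measure.pi ν).prod
      (Measure.pi fun _ : ι => Measure.infinitePi fun _ : ℕ => ρ)) =
      expNeg (∑ j, ∫⁻ x, (1 - ∫⁻ t, expNeg (F j (x, t)) ∂ρ) ∂(Λ j)) := by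
  rw [lintegral_prod]
  · simp_rw [expNeg_sum]
    have h1 : ∀ c : ι → Config, ∫⁻ h : ι → ℕ → ℝ, ∏ j, expNeg (markedSum (F j) (c j) (h j))
        ∂(Measure.pi fun _ : ι => Measure.infinitePi fun _ : ℕ => ρ) =
        ∏ j, ∫⁻ h, expNeg (markedSum (F j) (c j) h) ∂(Measure.infinitePi fun _ : ℕ => ρ) :=
      fun c => lintegral_fintype_prod _ (f := fun j h => expNeg (markedSum (F j) (c j) h))
        fun j => measurable_expNeg.comp
          (measurable_markedSum (hF j) measurable_const measurable_id)
    simp_rw [h1]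
    rw [lintegral_fintype_prod ν (f := fun j c => ∫⁻ h, expNeg (markedSum (F j) c h)
      ∂(Measure.infinitePi fun _ : ℕ => ρ))]
    · exact Finset.prod_congr rfl fun j _ => (hν j).lintegral_expNeg_markedSum (hF j)
    · intro j
      exact Measurable.lintegral_prod_right' (f := fun z : Config × (ℕ → ℝ) =>
        expNeg (markedSum (F j) z.1 z.2))
        (measurable_expNeg.comp (measurable_markedSum (hF j) measurable_fst measurable_snd))
  · refine (measurable_expNeg.comp (Finset.measurable_fun_sum _ fun j _ => ?_)).aemeasurable
    exact measurable_markedSum (hF j) ((measurable_pi_apply j).comp measurable_fst)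
      ((measurable_pi_apply j).comp measurable_snd)

end Marks

end HetNet
end

noncomputable section
namespace HetNet

/-! ### The distance to the closest point of a Poisson process -/

lemma nearest_lt_iff (c : Config) (a : ℝ≥0∞) :
    nearest c < a ↔ ∃ i : ℕ, (i : ℕ∞) < c.1 ∧ ‖c.2 i‖ₑ < a := by
  simp [nearest, iInf_lt_iff]

/-- The inequality is not strict because the ball is open. -/
lemma le_nearest_iff_count_eq_zero (c : Config) (a : ℝ) :
    ENNReal.ofReal a ≤ nearest c ↔ count c (Metric.ball 0 a) = 0 := by
  rw [← not_lt, nearest_lt_iff, count, ENNReal.tsum_eq_zero, not_exists]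
  refine forall_congr' fun i => ?_
  have : ‖c.2 i‖ₑ < ENNReal.ofReal a ↔ ‖c.2 i‖ < a := by
    rw [← ofReal_norm, ENNReal.ofReal_lt_ofReal_iff_of_nonneg (norm_nonneg _)]
  by_cases hi : (i : ℕ∞) < c.1 <;> by_cases hb : ‖c.2 i‖ < a <;>
    simp [Set.indicator, hi, hb, this]

@[fun_prop] lemma measurable_nearest : Measurable nearest := by
  refine measurable_of_Iio fun a => ?_
  have : nearest ⁻¹' Set.Iio a = ⋃ i : ℕ, {c : Config | (i : ℕ∞) < c.1} ∩ {c | ‖c.2 i‖ₑ < a} := by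
    ext c
    simp [nearest_lt_iff]
  rw [this]
  refine MeasurableSet.iUnion fun i => MeasurableSet.inter ?_ ?_
  · exact measurable_fst (MeasurableSet.of_discrete (s := {n : ℕ∞ | (i : ℕ∞) < n}))
  · exact measurableSet_lt (by fun_prop) measurable_const

variable {Ω : Type*} [MeasurableSpace Ω] {μ : Measure Ω}

lemma volume_ball_plane (a : ℝ) :
    (volume : Measure Plane) (Metric.ball 0 a) = ENNReal.ofReal a ^ 2 * ENNReal.ofReal Real.pi := by
  rw [EuclideanSpace.volume_ball_fin_two]

/-- The void probability of a disc of radius `a`, whose intensity is `π l a²`. -/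
lemma measure_le_nearest {X : Ω → Config} {l : ℝ} (hl : 0 < l)
    (hX : IsPoisson μ X (ENNReal.ofReal l • (volume : Measure Plane))) {a : ℝ} (ha : 0 ≤ a) :
    μ {ω | ENNReal.ofReal a ≤ nearest (X ω)} =
      ENNReal.ofReal (Real.exp (-(Real.pi * l * a ^ 2))) := by
  have hΛ : (ENNReal.ofReal l • (volume : Measure Plane)) (Metric.ball 0 a) =
      ENNReal.ofReal (Real.pi * l * a ^ 2) := by
    rw [Measure.smul_apply, volume_ball_plane, smul_eq_mul, ← ENNReal.ofReal_pow ha,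
      ← ENNReal.ofReal_mul (by positivity), ← ENNReal.ofReal_mul (by positivity)]
    congr 1; ring
  have h := hX.lintegral_expNeg_count (B := Metric.ball 0 a) measurableSet_ball
    (by rw [hΛ]; exact ENNReal.ofReal_ne_top) ⊤
  -- At `⊤` the Laplace variable detects emptiness: `⊤ * 0 = 0` gives one, and any positive count
  -- gives zero.
  have hind : ∀ ω, expNeg (⊤ * count (X ω) (Metric.ball 0 a)) =
      {ω | ENNReal.ofReal a ≤ nearest (X ω)}.indicator 1 ω := by
    intro ω
    by_cases h0 : count (X ω) (Metric.ball 0 a) = 0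
    · simp [Set.indicator, le_nearest_iff_count_eq_zero, h0]
    · simp [Set.indicator, le_nearest_iff_count_eq_zero, h0, ENNReal.top_mul h0]
  have hm : MeasurableSet {ω | ENNReal.ofReal a ≤ nearest (X ω)} :=
    measurableSet_le measurable_const (measurable_nearest.comp hX.measurable)
  simp_rw [hind] at h
  rw [lintegral_indicator_one hm, hΛ, expNeg_top, tsub_zero, one_mul,
    expNeg_ofReal (by positivity)] at h
  exact h

/-- The law of the distance to the closest point of a Poisson process of density `l`. -/
def rayleigh (l : ℝ) : Measure ℝ :=
  (volume.restrict (Set.Ioi 0)).withDensity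
    fun r => ENNReal.ofReal (2 * Real.pi * l * r * Real.exp (-(Real.pi * l * r ^ 2)))

lemma lintegral_Ioi_gaussian {c : ℝ} (hc : 0 < c) {a : ℝ} (ha : 0 ≤ a) :
    ∫⁻ r in Set.Ioi a, ENNReal.ofReal (2 * Real.pi * c * r * Real.exp (-(Real.pi * c * r ^ 2))) =
      ENNReal.ofReal (Real.exp (-(Real.pi * c * a ^ 2))) := by
  have hd : ∀ x ∈ Set.Ici a, HasDerivAt (fun r : ℝ => -Real.exp (-(Real.pi * c * r ^ 2)))
      (2 * Real.pi * c * x * Real.exp (-(Real.pi * c * x ^ 2))) x := by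
    intro x _
    have h1 : HasDerivAt (fun r : ℝ => -(Real.pi * c * r ^ 2)) (-(Real.pi * c * (2 * x))) x := by
      simpa using ((hasDerivAt_pow 2 x).const_mul (Real.pi * c)).fun_neg
    exact h1.exp.fun_neg.congr_deriv (by ring)
  have hpos : ∀ x ∈ Set.Ioi a,
      0 ≤ 2 * Real.pi * c * x * Real.exp (-(Real.pi * c * x ^ 2)) := by
    intro x hx
    have : 0 ≤ x := ha.trans (le_of_lt hx)
    positivity
  have ht : Filter.Tendsto (fun r : ℝ => -Real.exp (-(Real.pi * c * r ^ 2))) Filter.atTop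
      (nhds 0) := by
    rw [← neg_zero]
    refine (Real.tendsto_exp_neg_atTop_nhds_zero.comp ?_).neg
    exact (Filter.tendsto_pow_atTop two_ne_zero).const_mul_atTop (by positivity)
  have hint := integrableOn_Ioi_deriv_of_nonneg' hd hpos ht
  have hval := integral_Ioi_of_hasDerivAt_of_nonneg' hd hpos ht
  rw [← ofReal_integral_eq_lintegral_ofReal hint, hval]
  · simp
  · exact (ae_restrict_iff' measurableSet_Ioi).2 (.of_forall hpos)

lemma rayleigh_Ici {l : ℝ} (hl : 0 < l) (a : ℝ) :
    rayleigh l (Set.Ici a) = ENNReal.ofReal (Real.exp (-(Real.pi * l * (max a 0) ^ 2))) := by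
  rw [rayleigh, withDensity_apply _ measurableSet_Ici, Measure.restrict_restrict measurableSet_Ici,
    ← lintegral_Ioi_gaussian hl (le_max_right a 0)]
  refine setLIntegral_congr ?_
  rcases le_or_gt a 0 with h | h
  · have : Set.Ici a ∩ Set.Ioi 0 = Set.Ioi 0 :=
      Set.inter_eq_right.2 fun x hx => h.trans (le_of_lt hx)
    rw [max_eq_right h, this]
    exact Filter.EventuallyEq.rfl
  · have : Set.Ici a ∩ Set.Ioi 0 = Set.Ici a :=
      Set.inter_eq_left.2 fun x hx => lt_of_lt_of_le h hx
    rw [max_eq_left h.le, this]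
    exact Ioi_ae_eq_Ici.symm

lemma rayleigh_univ {l : ℝ} (hl : 0 < l) : rayleigh l Set.univ = 1 := by
  have := lintegral_Ioi_gaussian hl le_rfl
  rw [rayleigh, withDensity_apply _ .univ, Measure.restrict_univ, this]
  simp

lemma isProbabilityMeasure_rayleigh {l : ℝ} (hl : 0 < l) : IsProbabilityMeasure (rayleigh l) :=
  ⟨rayleigh_univ hl⟩

lemma ae_nearest_ne_top {X : Ω → Config} {l : ℝ} (hl : 0 < l)
    (hX : IsPoisson μ X (ENNReal.ofReal l • (volume : Measure Plane))) :
    ∀ᵐ ω ∂μ, nearest (X ω) ≠ ⊤ := by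
  rw [ae_iff]
  simp only [not_not]
  have ht : Filter.Tendsto (fun n : ℕ => ENNReal.ofReal (Real.exp (-(Real.pi * l * (n : ℝ) ^ 2))))
      Filter.atTop (nhds 0) := by
    rw [← ENNReal.ofReal_zero]
    refine ENNReal.tendsto_ofReal (Real.tendsto_exp_neg_atTop_nhds_zero.comp ?_)
    exact ((Filter.tendsto_pow_atTop two_ne_zero).comp
      tendsto_natCast_atTop_atTop).const_mul_atTop (by positivity)
  refine le_antisymm (ge_of_tendsto' ht fun n => ?_) zero_le
  rw [← measure_le_nearest hl hX n.cast_nonneg]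
  exact measure_mono fun ω (h : nearest (X ω) = ⊤) => by simp [h]

/-- Probability measures on the line are determined by their tails on `Ici a`, which are void
probabilities. `toReal` sends the empty configuration to distance zero, but this is a null event. -/
lemma map_nearest_toReal {X : Ω → Config} {l : ℝ} (hl : 0 < l)
    (hX : IsPoisson μ X (ENNReal.ofReal l • (volume : Measure Plane))) :
    μ.map (fun ω => (nearest (X ω)).toReal) = rayleigh l := by
  have hprob := hX.isProbabilityMeasure
  have hprob' := isProbabilityMeasure_rayleigh hl
  have hm : Measurable fun ω => (nearest (X ω)).toReal :=
    (measurable_nearest.comp hX.measurable).ennreal_toReal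
  have hprob2 := Measure.isProbabilityMeasure_map (μ := μ) hm.aemeasurable
  refine Measure.ext_of_Ici _ _ fun a => ?_
  rw [Measure.map_apply hm measurableSet_Ici, rayleigh_Ici hl,
    ← measure_le_nearest hl hX (le_max_right a 0)]
  refine measure_congr ?_
  filter_upwards [ae_nearest_ne_top hl hX] with ω hω
  refine propext ?_
  change a ≤ (nearest (X ω)).toReal ↔ ENNReal.ofReal (max a 0) ≤ nearest (X ω)
  rw [ENNReal.ofReal_le_iff_le_toReal hω]
  simp

lemma ae_nearest_toReal_pos {X : Ω → Config} {l : ℝ} (hl : 0 < l)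
    (hX : IsPoisson μ X (ENNReal.ofReal l • (volume : Measure Plane))) :
    ∀ᵐ ω ∂μ, 0 < (nearest (X ω)).toReal := by
  have hm : Measurable fun ω => (nearest (X ω)).toReal :=
    (measurable_nearest.comp hX.measurable).ennreal_toReal
  have : ∀ᵐ r ∂(rayleigh l), r ∈ Set.Ioi (0 : ℝ) :=
    (withDensity_absolutelyContinuous _ _).ae_le (ae_restrict_mem measurableSet_Ioi)
  rw [← map_nearest_toReal hl hX] at this
  exact ae_of_ae_map hm.aemeasurable this

/-! ### Association in the half-duplex network -/

lemma other_ne (k : Fin 2) : k ≠ other k := by fin_cases k <;> decide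

lemma forall_tier_iff {q : Fin 2 → Prop} (k : Fin 2) : (∀ t, q t) ↔ q k ∧ q (other k) := by
  fin_cases k <;> simp [other, Fin.forall_fin_two, and_comm]

lemma prod_tier {M : Type*} [CommMonoid M] (k : Fin 2) (f : Fin 2 → M) :
    ∏ t, f t = f k * f (other k) := by
  fin_cases k <;> simp [other, Fin.prod_univ_two, mul_comm]

lemma rxPower_ofReal (p : Params) (k : Fin 2) {r : ℝ} (hr : 0 < r) :
    rxPower p k (ENNReal.ofReal r) = ENNReal.ofReal (p.P k * r ^ (-p.α)) := by
  rw [rxPower, ENNReal.ofReal_rpow_of_pos hr, ENNReal.ofReal_mul (p.P_pos k).le]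

lemma Params.α_pos (p : Params) : 0 < p.α := two_pos.trans p.two_lt_α

lemma ratio_pos (p : Params) (k t : Fin 2) : 0 < ratio p k t :=
  Real.rpow_pos_of_pos (div_pos (p.P_pos t) (p.P_pos k)) _

/-- Taking `α`-th roots turns the comparison of powers into a linear comparison of distances. -/
lemma rxPower_le_rxPower_iff (p : Params) (k t : Fin 2) {r s : ℝ} (hr : 0 < r) (hs : 0 < s) :
    rxPower p t (ENNReal.ofReal s) ≤ rxPower p k (ENNReal.ofReal r) ↔ ratio p k t * r ≤ s := by
  have hα := p.α_pos
  have hk := p.P_pos k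
  have ht := p.P_pos t
  rw [rxPower_ofReal p t hs, rxPower_ofReal p k hr, ENNReal.ofReal_le_ofReal_iff (by positivity),
    Real.rpow_neg hs.le, Real.rpow_neg hr.le, ← div_eq_mul_inv, ← div_eq_mul_inv,
    div_le_div_iff₀ (by positivity) (by positivity),
    ← Real.rpow_le_rpow_iff (mul_pos (ratio_pos p k t) hr).le hs.le hα,
    Real.mul_rpow (ratio_pos p k t).le hr.le, ratio, ← Real.rpow_mul (by positivity),
    one_div_mul_cancel hα.ne', Real.rpow_one, div_mul_eq_mul_div, div_le_iff₀ hk]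
  rw [mul_comm (s ^ p.α)]

variable (p : Params) {Φ : Fin 2 → Ω → Config}

lemma measurableSet_assocEvent (hΦ : ∀ k, Measurable (Φ k)) (k : Fin 2) :
    MeasurableSet (assocEvent p Φ k) := by
  have hm : ∀ t, Measurable fun ω => rxPower p t (nearest (Φ t ω)) := fun t =>
    measurable_const.mul ((measurable_nearest.comp (hΦ t)).pow_const _)
  have : assocEvent p Φ k =
      ⋂ t, {ω | rxPower p t (nearest (Φ t ω)) ≤ rxPower p k (nearest (Φ k ω))} := by
    ext ω; simp [assocEvent]
  rw [this]
  exact MeasurableSet.iInter fun t => measurableSet_le (hm t) (hm k)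

variable (hΦ : ∀ k, IsPoisson μ (Φ k) (ENNReal.ofReal (p.lam k) • (volume : Measure Plane)))

include hΦ in
lemma ae_mem_assocEvent_iff (k : Fin 2) : ∀ᵐ ω ∂μ, ω ∈ assocEvent p Φ k ↔
    ratio p k (other k) * (nearest (Φ k ω)).toReal ≤ (nearest (Φ (other k) ω)).toReal := by
  filter_upwards [ae_nearest_ne_top (p.lam_pos k) (hΦ k),
    ae_nearest_ne_top (p.lam_pos (other k)) (hΦ (other k)),
    ae_nearest_toReal_pos (p.lam_pos k) (hΦ k),
    ae_nearest_toReal_pos (p.lam_pos (other k)) (hΦ (other k))] with ω h1 h2 h3 h4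
  rw [← rxPower_le_rxPower_iff p k (other k) h3 h4, ENNReal.ofReal_toReal h1,
    ENNReal.ofReal_toReal h2]
  change (∀ t, _) ↔ _
  rw [forall_tier_iff k]
  simp

include hΦ in
lemma ae_rxPower_lt_top (k : Fin 2) : ∀ᵐ ω ∂μ, rxPower p k (nearest (Φ k ω)) < ⊤ := by
  filter_upwards [ae_nearest_ne_top (p.lam_pos k) (hΦ k),
    ae_nearest_toReal_pos (p.lam_pos k) (hΦ k)] with ω h1 h3
  rw [← ENNReal.ofReal_toReal h1, rxPower_ofReal p k h3]
  exact ENNReal.ofReal_lt_top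

include hΦ in
-- The threshold is `⊤` and the received power is almost surely finite, the serving distance being
-- almost surely positive.
lemma userEvent_HD_ae_eq (k : Fin 2) :
    userEvent p halfDuplex Φ k .HD =ᵐ[μ] assocEvent p Φ k := by
  filter_upwards [ae_rxPower_lt_top p hΦ k] with ω h
  refine propext ⟨fun h' => h'.1, fun h' => ⟨h', h⟩⟩

include hΦ in
lemma modeProb_FD (k : Fin 2) : modeProb p halfDuplex μ Φ k .FD = 0 := by
  have : μ (userEvent p halfDuplex Φ k .FD) = 0 := by
    refine measure_mono_null (t := {ω | ¬ rxPower p k (nearest (Φ k ω)) < ⊤}) ?_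
      (ae_iff.1 (ae_rxPower_lt_top p hΦ k))
    rintro ω ⟨-, h⟩
    exact not_lt.2 h
  simp [modeProb, Measure.real, this]

include hΦ in
lemma modeProb_HD (k : Fin 2) : modeProb p halfDuplex μ Φ k .HD = assocProb p μ Φ k :=
  measureReal_congr (userEvent_HD_ae_eq p hΦ k)

include hΦ in
-- The two nearest distances are independent Rayleigh variables. For a fixed `r`, the other tier
-- loses exactly when its distance is at least `ratio * r`, and this Gaussian tail times the
-- Rayleigh density at `r` is the integrand.
lemma measure_assocEvent_inter (hind : iIndepFun Φ μ) (k : Fin 2) {B : Set ℝ}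
    (hB : MeasurableSet B) :
    μ (assocEvent p Φ k ∩ {ω | (nearest (Φ k ω)).toReal ∈ B}) =
      ∫⁻ r in B ∩ Set.Ioi 0, ENNReal.ofReal (2 * Real.pi * p.lam k * distFactor p k r) := by
  have hprob := (hΦ k).isProbabilityMeasure
  have hm : ∀ t, Measurable fun ω => (nearest (Φ t ω)).toReal := fun t =>
    (measurable_nearest.comp (hΦ t).measurable).ennreal_toReal
  set q := other k
  have hpr := isProbabilityMeasure_rayleigh (p.lam_pos k)
  have hpr' := isProbabilityMeasure_rayleigh (p.lam_pos q)
  have hmap : μ.map (fun ω => ((nearest (Φ k ω)).toReal, (nearest (Φ q ω)).toReal)) =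
      (rayleigh (p.lam k)).prod (rayleigh (p.lam q)) := by
    rw [← map_nearest_toReal (p.lam_pos k) (hΦ k), ← map_nearest_toReal (p.lam_pos q) (hΦ q)]
    refine (indepFun_iff_map_prod_eq_prod_map_map (hm k).aemeasurable (hm q).aemeasurable).1 ?_
    exact (hind.indepFun (other_ne k)).comp (φ := fun c => (nearest c).toReal)
      (ψ := fun c => (nearest c).toReal) measurable_nearest.ennreal_toReal
      measurable_nearest.ennreal_toReal
  set S : Set (ℝ × ℝ) := {z | z.1 ∈ B ∧ ratio p k q * z.1 ≤ z.2}
  have hS : MeasurableSet S := (measurable_fst hB).inter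
    (measurableSet_le (measurable_const.mul measurable_fst) measurable_snd)
  have h1 : μ (assocEvent p Φ k ∩ {ω | (nearest (Φ k ω)).toReal ∈ B}) =
      μ ((fun ω => ((nearest (Φ k ω)).toReal, (nearest (Φ q ω)).toReal)) ⁻¹' S) := by
    refine measure_congr ?_
    filter_upwards [ae_mem_assocEvent_iff p hΦ k] with ω h
    refine propext ⟨fun h' => ⟨h'.2, h.1 h'.1⟩, fun h' => ⟨h.2 h'.2, h'.1⟩⟩
  rw [h1, ← Measure.map_apply ((hm k).prodMk (hm q)) hS, hmap, Measure.prod_apply hS]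
  have h2 : ∀ r, rayleigh (p.lam q) (Prod.mk r ⁻¹' S) =
      B.indicator (fun r => rayleigh (p.lam q) (Set.Ici (ratio p k q * r))) r := by
    intro r
    by_cases hr : r ∈ B
    · rw [Set.indicator_of_mem hr]; congr 1; ext s; simp [S, hr]
    · rw [Set.indicator_of_notMem hr]
      have : Prod.mk r ⁻¹' S = ∅ := by ext s; simp [S, hr]
      rw [this, measure_empty]
  simp_rw [h2]
  rw [lintegral_indicator hB, rayleigh, restrict_withDensity hB, Measure.restrict_restrict hB,
    lintegral_withDensity_eq_lintegral_mul₀ (by fun_prop)]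
  · refine setLIntegral_congr_fun (hB.inter measurableSet_Ioi) fun r hr => ?_
    have hr0 : (0 : ℝ) < r := hr.2
    have hl := p.lam_pos k
    simp only [Pi.mul_apply]
    rw [rayleigh_Ici (p.lam_pos q), max_eq_left (mul_pos (ratio_pos p k q) hr0).le,
      ← ENNReal.ofReal_mul (by positivity), distFactor, mul_assoc _ (Real.exp _),
      ← Real.exp_add, ← mul_assoc (2 * Real.pi * p.lam k)]
    congr 3
    rw [ratio]; ring
  · simp_rw [rayleigh_Ici (p.lam_pos q)]
    fun_prop

lemma tierProb_eq (k : Fin 2) :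
    tierProb p k = p.lam k / (p.lam k + p.lam (other k) * ratio p k (other k) ^ 2) := by
  have hk := p.P_pos k
  have hq := p.P_pos (other k)
  have h1 : ratio p k (other k) ^ 2 = p.P (other k) ^ (2 / p.α) / p.P k ^ (2 / p.α) := by
    rw [ratio, ← Real.rpow_natCast, ← Real.rpow_mul (by positivity), Real.div_rpow hq.le hk.le]
    congr 2 <;> push_cast <;> ring
  have h2 : 0 < p.P k ^ (2 / p.α) := by positivity
  have h3 : 0 < p.P (other k) ^ (2 / p.α) := by positivity
  have := p.lam_pos k
  have := p.lam_pos (other k)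
  rw [tierProb, h1]
  field_simp

lemma tierProb_pos (k : Fin 2) : 0 < tierProb p k := by
  have := p.lam_pos k
  have := p.lam_pos (other k)
  have := ratio_pos p k (other k)
  rw [tierProb_eq]; positivity

/-- The two Gaussian exponents merge into that of a single Poisson process of density `c`, so the
integrand is a Rayleigh density of parameter `c` times the constant `λ_k / c`, which is `tierProb`.
-/
lemma lintegral_distFactor (k : Fin 2) :
    ∫⁻ r in Set.Ioi 0, ENNReal.ofReal (2 * Real.pi * p.lam k * distFactor p k r) =
      ENNReal.ofReal (tierProb p k) := by
  have h1 := p.lam_pos k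
  have h2 := p.lam_pos (other k)
  have h3 := ratio_pos p k (other k)
  set c := p.lam k + p.lam (other k) * ratio p k (other k) ^ 2 with hc
  have hcpos : 0 < c := by positivity
  have h4 : ∀ r, ENNReal.ofReal (2 * Real.pi * p.lam k * distFactor p k r) =
      ENNReal.ofReal (tierProb p k) *
        ENNReal.ofReal (2 * Real.pi * c * r * Real.exp (-(Real.pi * c * r ^ 2))) := by
    intro r
    rw [← ENNReal.ofReal_mul (tierProb_pos p k).le, tierProb_eq, ← hc, distFactor]
    have : -(Real.pi * p.lam k * r ^ 2) -
        Real.pi * p.lam (other k) * (r * (p.P (other k) / p.P k) ^ (1 / p.α)) ^ 2 =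
        -(Real.pi * c * r ^ 2) := by
      rw [hc, ratio]; ring
    rw [this]
    congr 1
    field_simp
  simp_rw [h4]
  rw [lintegral_const_mul _ (by fun_prop), lintegral_Ioi_gaussian hcpos le_rfl]
  simp

include hΦ in
lemma measure_assocEvent (hind : iIndepFun Φ μ) (k : Fin 2) :
    μ (assocEvent p Φ k) = ENNReal.ofReal (tierProb p k) := by
  have := measure_assocEvent_inter p hΦ hind k .univ
  simpa [lintegral_distFactor] using this

include hΦ in
lemma assocProb_eq (hind : iIndepFun Φ μ) (k : Fin 2) :
    assocProb p μ Φ k = tierProb p k := by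
  rw [assocProb, Measure.real, measure_assocEvent p hΦ hind,
    ENNReal.toReal_ofReal (tierProb_pos p k).le]

include hΦ in
/-- The law of the distance to the serving base station in the half-duplex network. -/
lemma distLaw_eq (hind : iIndepFun Φ μ) (k : Fin 2) :
    distLaw p halfDuplex μ Φ k .HD = (volume.restrict (Set.Ioi 0)).withDensity
      fun r => ENNReal.ofReal (2 * Real.pi * p.lam k / tierProb p k * distFactor p k r) := by
  have hm : Measurable fun ω => (nearest (Φ k ω)).toReal :=
    (measurable_nearest.comp (hΦ k).measurable).ennreal_toReal
  have hE := measurableSet_assocEvent p (fun k => (hΦ k).measurable) k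
  have hA := tierProb_pos p k
  ext B hB
  rw [distLaw, Measure.map_apply hm hB, ProbabilityTheory.cond,
    Measure.restrict_congr_set (userEvent_HD_ae_eq p hΦ k),
    measure_congr (userEvent_HD_ae_eq p hΦ k), Measure.smul_apply,
    Measure.restrict_apply (hm hB), Set.inter_comm, withDensity_apply _ hB,
    Measure.restrict_restrict hB, measure_assocEvent p hΦ hind, smul_eq_mul]
  have h1 := measure_assocEvent_inter p hΦ hind k hB
  rw [show ((fun ω => (nearest (Φ k ω)).toReal) ⁻¹' B) =
    {ω | (nearest (Φ k ω)).toReal ∈ B} from rfl, h1, ← lintegral_const_mul]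
  · refine lintegral_congr fun r => ?_
    rw [← ENNReal.ofReal_inv_of_pos hA, ← ENNReal.ofReal_mul (by positivity)]
    congr 1
    field_simp
  · unfold distFactor; fun_prop

end HetNet
end

noncomputable section
namespace HetNet

/-! ### The exponential law -/

lemma expMeasure_one_eq :
    expMeasure 1 = (volume.restrict (Set.Ioi 0)).withDensity
      fun t => ENNReal.ofReal (Real.exp (-t)) := by
  have h : expMeasure 1 = volume.withDensity (exponentialPDF 1) := rfl
  rw [h, ← withDensity_indicator measurableSet_Ioi]
  refine withDensity_congr_ae ?_
  -- The two densities differ only at the origin.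
  have : ∀ᵐ t : ℝ, t ≠ 0 := by simp [ae_iff]
  filter_upwards [this] with t ht
  rw [exponentialPDF_eq]
  rcases lt_or_gt_of_ne ht with h | h
  · simp [Set.indicator, not_le.2 h, h.le]
  · simp [Set.indicator, h, h.le]

instance : IsProbabilityMeasure (expMeasure 1) := isProbabilityMeasure_expMeasure one_pos

lemma lintegral_Ioi_exp {c : ℝ} (hc : 0 < c) (a : ℝ) :
    ∫⁻ t in Set.Ioi a, ENNReal.ofReal (Real.exp (-(c * t))) =
      ENNReal.ofReal (Real.exp (-(c * a)) / c) := by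
  simp_rw [← neg_mul]
  rw [← ofReal_integral_eq_lintegral_ofReal (integrableOn_exp_mul_Ioi (neg_lt_zero.2 hc) a)
    (.of_forall fun t => (Real.exp_pos _).le), integral_exp_mul_Ioi (neg_lt_zero.2 hc)]
  congr 1
  rw [neg_div_neg_eq]

lemma expMeasure_Ioi {a : ℝ} (ha : 0 ≤ a) :
    expMeasure 1 (Set.Ioi a) = ENNReal.ofReal (Real.exp (-a)) := by
  rw [expMeasure_one_eq, withDensity_apply _ measurableSet_Ioi,
    Measure.restrict_restrict measurableSet_Ioi, Set.Ioi_inter_Ioi, sup_of_le_left ha]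
  simpa using lintegral_Ioi_exp one_pos a

lemma lintegral_expNeg_expMeasure {c : ℝ} (hc : 0 ≤ c) :
    ∫⁻ t, expNeg (ENNReal.ofReal (c * t)) ∂(expMeasure 1) = ENNReal.ofReal (laplaceExp c) := by
  rw [expMeasure_one_eq, lintegral_withDensity_eq_lintegral_mul₀ (by fun_prop) (by fun_prop)]
  have h : ∀ t ∈ Set.Ioi (0 : ℝ), ((fun t => ENNReal.ofReal (Real.exp (-t))) *
      fun t => expNeg (ENNReal.ofReal (c * t))) t =
      ENNReal.ofReal (Real.exp (-((1 + c) * t))) := by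
    intro t ht
    simp only [Pi.mul_apply]
    rw [expNeg_ofReal (mul_nonneg hc (le_of_lt ht)), ← ENNReal.ofReal_mul (Real.exp_pos _).le,
      ← Real.exp_add]
    congr 2; ring
  rw [setLIntegral_congr_fun measurableSet_Ioi h, lintegral_Ioi_exp (by positivity)]
  simp [laplaceExp]

/-! ### Finiteness of the shot noise -/

/-- If the Laplace exponent of the shot noise of a family of independent marked Poisson processes
is finite, then so is the shot noise. -/
theorem ae_sum_markedSum_ne_top {ρ : Measure ℝ} [IsProbabilityMeasure ρ] {ι : Type*} [Fintype ι]
    {Λ : ι → Measure Plane}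
    [∀ j, SigmaFinite (Λ j)] {ν : ι → Measure Config} [∀ j, IsProbabilityMeasure (ν j)]
    (hν : ∀ j, IsPoisson (ν j) id (Λ j)) {F : ι → Plane × ℝ → ℝ≥0∞}
    (hF : ∀ j, Measurable (F j)) (hfin : ∀ j, ∀ᵐ x ∂(Λ j), ∀ t, F j (x, t) ≠ ⊤)
    (hint : ∀ j, ∫⁻ x, (1 - ∫⁻ t, expNeg (F j (x, t)) ∂ρ) ∂(Λ j) ≠ ⊤) :
    ∀ᵐ z ∂((Measure.pi ν).prod
      (Measure.pi fun _ : ι => Measure.infinitePi fun _ : ℕ => ρ)),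
      ∑ j, markedSum (F j) (z.1 j) (z.2 j) ≠ ⊤ := by
  set W := (Measure.pi ν).prod (Measure.pi fun _ : ι => Measure.infinitePi fun _ : ℕ => ρ)
  set I : (ι → Config) × (ι → ℕ → ℝ) → ℝ≥0∞ := fun z => ∑ j, markedSum (F j) (z.1 j) (z.2 j)
    with hI
  have hIm : Measurable I := Finset.measurable_fun_sum _ fun j _ =>
    measurable_markedSum (hF j) ((measurable_pi_apply j).comp measurable_fst)
      ((measurable_pi_apply j).comp measurable_snd)
  -- Let the Laplace variable tend to zero: `E exp (-s I)` tends to the probability that `I` is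
  -- finite, while the Laplace exponent tends to zero, so that probability is one. The `s n` are at
  -- most one, for domination, and nonzero, so that `s n * ⊤ = ⊤`.
  set s : ℕ → ℝ≥0∞ := fun n => ((n : ℝ≥0∞) + 1)⁻¹
  have hs1 : ∀ n, s n ≤ 1 := fun n => ENNReal.inv_le_one.2 le_add_self
  have hs0 : ∀ n, s n ≠ 0 := fun n => ENNReal.inv_ne_zero.2 (by finiteness)
  have hslim : Filter.Tendsto s Filter.atTop (nhds 0) := by
    have := ENNReal.tendsto_inv_nat_nhds_zero.comp (Filter.tendsto_add_atTop_nat 1)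
    simpa [Function.comp_def] using this
  have hlim0 : ∀ y : ℝ≥0∞, y ≠ ⊤ →
      Filter.Tendsto (fun n => expNeg (s n * y)) Filter.atTop (nhds 1) := by
    intro y hy
    have := (continuous_expNeg.tendsto _).comp (ENNReal.Tendsto.mul_const hslim (.inr hy))
    rw [zero_mul, expNeg_zero] at this
    exact this
  have hL : ∀ n, ∫⁻ z, expNeg (s n * I z) ∂W =
      expNeg (∑ j, ∫⁻ x, (1 - ∫⁻ t, expNeg (s n * F j (x, t)) ∂ρ) ∂(Λ j)) := by
    intro n
    rw [← lintegral_expNeg_sum_markedSum hν (F := fun j z => s n * F j z)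
      (fun j => measurable_const.mul (hF j))]
    refine lintegral_congr fun z => ?_
    congr 1
    rw [hI]
    simp only [Finset.mul_sum, markedSum, ← ENNReal.tsum_mul_left]
    refine Finset.sum_congr rfl fun j _ => tsum_congr fun i => ?_
    by_cases hi : (i : ℕ∞) < (z.1 j).1 <;> simp [Set.indicator, hi]
  have hR : Filter.Tendsto (fun n => ∫⁻ z, expNeg (s n * I z) ∂W) Filter.atTop (nhds 1) := by
    simp_rw [hL]
    suffices h : ∀ j, Filter.Tendsto
        (fun n => ∫⁻ x, (1 - ∫⁻ t, expNeg (s n * F j (x, t)) ∂ρ) ∂(Λ j)) Filter.atTop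
        (nhds (∫⁻ _, 0 ∂(Λ j))) by
      have h' := (continuous_expNeg.tendsto _).comp
        (tendsto_finsetSum Finset.univ fun j _ => h j)
      simp only [lintegral_zero, Finset.sum_const_zero, expNeg_zero] at h'
      exact h'
    intro j
    have hmeas : ∀ n, Measurable fun x => 1 - ∫⁻ t, expNeg (s n * F j (x, t)) ∂ρ := fun n =>
      measurable_const.sub (Measurable.lintegral_prod_right'
        (f := fun z => expNeg (s n * F j z)) (measurable_expNeg.comp (measurable_const.mul (hF j))))
    -- The integrand at Laplace variable one dominates, and `hint` says that it is integrable.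
    refine tendsto_lintegral_of_dominated_convergence
      (fun x => 1 - ∫⁻ t, expNeg (F j (x, t)) ∂ρ) hmeas (fun n => .of_forall fun x => ?_)
      (hint j) ?_
    · refine tsub_le_tsub_left (lintegral_mono fun t => expNeg_antitone ?_) 1
      exact mul_le_of_le_one_left zero_le (hs1 n)
    · filter_upwards [hfin j] with x hx
      rw [← tsub_self (1 : ℝ≥0∞)]
      refine ENNReal.Tendsto.sub tendsto_const_nhds ?_ (.inl ENNReal.one_ne_top)
      have h1 : (1 : ℝ≥0∞) = ∫⁻ _, 1 ∂ρ := by simp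
      rw [h1]
      refine tendsto_lintegral_of_dominated_convergence (fun _ => 1) (fun n => ?_)
        (fun n => .of_forall fun t => expNeg_le_one _) (by simp)
        (.of_forall fun t => hlim0 _ (hx t))
      exact measurable_expNeg.comp (measurable_const.mul ((hF j).comp measurable_prodMk_left))
  have hLim : Filter.Tendsto (fun n => ∫⁻ z, expNeg (s n * I z) ∂W) Filter.atTop
      (nhds (∫⁻ z, {z | I z ≠ ⊤}.indicator 1 z ∂W)) := by
    refine tendsto_lintegral_of_dominated_convergence (fun _ => 1)
      (fun n => measurable_expNeg.comp (measurable_const.mul hIm))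
      (fun n => .of_forall fun z => expNeg_le_one _) (by simp) (.of_forall fun z => ?_)
    by_cases hz : I z = ⊤
    · simp [Set.indicator, hz, ENNReal.mul_top (hs0 _)]
    · simpa [Set.indicator, hz] using hlim0 _ hz
  have hset : MeasurableSet {z | I z ≠ ⊤} := (hIm (measurableSet_singleton ⊤)).compl
  have h1 := tendsto_nhds_unique hLim hR
  rw [lintegral_indicator_one hset] at h1
  exact (prob_compl_eq_zero_iff hset).2 h1

/-! ### Radial intensities -/

lemma laplaceExp_nonneg {x : ℝ} (hx : 0 ≤ x) : 0 ≤ laplaceExp x := by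
  rw [laplaceExp]; positivity

lemma laplaceExp_le_one {x : ℝ} (hx : 0 ≤ x) : laplaceExp x ≤ 1 := by
  rw [laplaceExp]; exact div_le_one_of_le₀ (by linarith) (by positivity)

lemma one_sub_laplaceExp_le {x : ℝ} (hx : 0 ≤ x) : 1 - laplaceExp x ≤ x := by
  have : 1 - laplaceExp x = x / (1 + x) := by rw [laplaceExp]; field_simp; ring
  rw [this]
  exact div_le_self hx (by linarith)

@[fun_prop] lemma measurable_laplaceExp : Measurable laplaceExp := by
  unfold laplaceExp; fun_prop

/-- On `(0, 1]` the integrand is at most `M`. Beyond one, `1 - 1 / (1 + x) ≤ x` bounds it by a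
multiple of `y^(1 - α)`, integrable because `α > 2`. -/
lemma integrableOn_one_sub_laplaceExp {w : ℝ → ℝ} (hw : Measurable w) {M b α : ℝ}
    (hw0 : ∀ y, 0 < y → 0 ≤ w y) (hwM : ∀ y, 0 < y → w y ≤ M) (hb : 0 ≤ b) (hα : 2 < α) :
    IntegrableOn (fun y => w y * y * (1 - laplaceExp (b / y ^ α))) (Set.Ioi 0) := by
  have hm : Measurable fun y : ℝ => w y * y * (1 - laplaceExp (b / y ^ α)) := by fun_prop
  have hpos : ∀ y : ℝ, 0 < y → 0 ≤ w y * y * (1 - laplaceExp (b / y ^ α)) := fun y hy =>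
    mul_nonneg (mul_nonneg (hw0 y hy) hy.le)
      (sub_nonneg.2 (laplaceExp_le_one (div_nonneg hb (by positivity))))
  rw [← Set.Ioc_union_Ioi_eq_Ioi zero_le_one]
  refine IntegrableOn.union ?_ ?_
  · refine Integrable.mono' (g := fun _ => M) (by simp) hm.aestronglyMeasurable ?_
    refine (ae_restrict_iff' measurableSet_Ioc).2 (.of_forall fun y hy => ?_)
    have h1 := laplaceExp_nonneg (x := b / y ^ α) (div_nonneg hb (by have := hy.1; positivity))
    rw [Real.norm_of_nonneg (hpos y hy.1)]
    have h2 : w y * y ≤ M * 1 := mul_le_mul (hwM y hy.1) hy.2 hy.1.le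
      ((hw0 y hy.1).trans (hwM y hy.1))
    have h3 : 0 ≤ w y * y := mul_nonneg (hw0 y hy.1) hy.1.le
    nlinarith
  · refine Integrable.mono' (g := fun y => M * b * y ^ (1 - α)) ?_ hm.aestronglyMeasurable ?_
    · exact (integrableOn_Ioi_rpow_of_lt (by linarith) one_pos).const_mul _
    · refine (ae_restrict_iff' measurableSet_Ioi).2 (.of_forall fun y hy => ?_)
      have hy0 : (0 : ℝ) < y := one_pos.trans hy
      rw [Real.norm_of_nonneg (hpos y hy0)]
      have h1 := one_sub_laplaceExp_le (x := b / y ^ α) (div_nonneg hb (by positivity))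
      have h4 := laplaceExp_le_one (x := b / y ^ α) (div_nonneg hb (by positivity))
      calc w y * y * (1 - laplaceExp (b / y ^ α)) ≤ M * y * (b / y ^ α) := by
            refine mul_le_mul (mul_le_mul_of_nonneg_right (hwM y hy0) hy0.le) h1
              (by linarith) (mul_nonneg ((hw0 y hy0).trans (hwM y hy0)) hy0.le)
        _ = M * b * y ^ (1 - α) := by
            rw [Real.rpow_sub hy0, Real.rpow_one]; ring

/-- Polar coordinates; the constant `2 π` is the dimension times the area of the unit disc. -/
lemma lintegral_plane_radial {f : ℝ → ℝ} (hf0 : ∀ y, 0 ≤ y → 0 ≤ f y)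
    (hint : IntegrableOn (fun y => y * f y) (Set.Ioi 0)) :
    ∫⁻ x : Plane, ENNReal.ofReal (f ‖x‖) =
      ENNReal.ofReal (2 * Real.pi * ∫ y in Set.Ioi (0 : ℝ), y * f y) := by
  have hrank : Module.finrank ℝ Plane = 2 := by simp
  have h1 : Integrable (fun x : Plane => f ‖x‖) := by
    rw [integrable_fun_norm_addHaar volume, hrank]
    simpa using hint
  have h2 := integral_fun_norm_addHaar (volume : Measure Plane) f
  rw [hrank] at h2
  rw [← ofReal_integral_eq_lintegral_ofReal h1 (.of_forall fun x => hf0 _ (norm_nonneg _)), h2,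
    Measure.real, volume_ball_plane]
  simp only [ENNReal.ofReal_one, one_pow, one_mul, ENNReal.toReal_ofReal Real.pi_pos.le,
    nsmul_eq_mul, smul_eq_mul, Nat.add_one_sub_one, pow_one]
  congr 1
  push_cast
  ring

/-- The Laplace exponent of the interference of a Poisson process of radial intensity `w`, at
`s`, when every node transmits with power `P`. -/
lemma laplaceExponent_radial {w : ℝ → ℝ} (hw : Measurable w) {M s P α : ℝ}
    (hw0 : ∀ y, 0 ≤ y → 0 ≤ w y) (hwM : ∀ y, 0 < y → w y ≤ M) (hs : 0 ≤ s) (hP : 0 < P)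
    (hα : 2 < α) :
    ∫⁻ x, (1 - ∫⁻ t, expNeg (ENNReal.ofReal s * (ENNReal.ofReal (P * t) * ‖x‖ₑ ^ (-α)))
        ∂(expMeasure 1)) ∂((volume : Measure Plane).withDensity
          fun x => ENNReal.ofReal (w ‖x‖)) =
      ENNReal.ofReal (2 * Real.pi * ∫ y in Set.Ioi (0 : ℝ),
        w y * y * (1 - laplaceExp (s * P / y ^ α))) := by
  have hpos : ∀ y : ℝ, 0 ≤ y → 0 ≤ s * P / y ^ α := fun y hy => by positivity
  -- At the origin the path loss is `⊤` on the left, whereas the real power on the right takes a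
  -- default value; this point is null.
  have hker : ∀ x : Plane, x ≠ 0 →
      (1 - ∫⁻ t, expNeg (ENNReal.ofReal s * (ENNReal.ofReal (P * t) * ‖x‖ₑ ^ (-α)))
        ∂(expMeasure 1)) = ENNReal.ofReal (1 - laplaceExp (s * P / ‖x‖ ^ α)) := by
    intro x hx
    have hx0 : 0 < ‖x‖ := norm_pos_iff.2 hx
    have h1 : ∀ t, ENNReal.ofReal s * (ENNReal.ofReal (P * t) * ‖x‖ₑ ^ (-α)) =
        ENNReal.ofReal (s * P / ‖x‖ ^ α * t) := by
      intro t
      rw [← ofReal_norm, ENNReal.ofReal_rpow_of_pos hx0, ← ENNReal.ofReal_mul' (by positivity),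
        ← ENNReal.ofReal_mul hs, Real.rpow_neg hx0.le]
      congr 1; ring
    simp_rw [h1]
    rw [lintegral_expNeg_expMeasure (hpos _ hx0.le),
      ENNReal.ofReal_sub _ (laplaceExp_nonneg (hpos _ hx0.le)), ENNReal.ofReal_one]
  have hne : ∀ᵐ x : Plane, x ≠ 0 := by simp [ae_iff]
  have hae : (fun x : Plane => 1 - ∫⁻ t, expNeg (ENNReal.ofReal s *
      (ENNReal.ofReal (P * t) * ‖x‖ₑ ^ (-α))) ∂(expMeasure 1)) =ᵐ[volume]
      fun x => ENNReal.ofReal (1 - laplaceExp (s * P / ‖x‖ ^ α)) := by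
    filter_upwards [hne] with x hx using hker x hx
  rw [lintegral_congr_ae ((withDensity_absolutelyContinuous _ _).ae_eq hae),
    lintegral_withDensity_eq_lintegral_mul₀ (by fun_prop) (by fun_prop)]
  have h2 : ∀ x : Plane, ENNReal.ofReal (w ‖x‖) *
      ENNReal.ofReal (1 - laplaceExp (s * P / ‖x‖ ^ α)) =
      ENNReal.ofReal ((fun y => w y * (1 - laplaceExp (s * P / y ^ α))) ‖x‖) := fun x => by
    rw [← ENNReal.ofReal_mul (hw0 _ (norm_nonneg _))]
  have h3 : ∀ y, y * (w y * (1 - laplaceExp (s * P / y ^ α))) =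
      w y * y * (1 - laplaceExp (s * P / y ^ α)) := fun y => by ring
  simp_rw [Pi.mul_apply, h2]
  rw [lintegral_plane_radial (f := fun y => w y * (1 - laplaceExp (s * P / y ^ α)))]
  · simp_rw [h3]
  · intro y hy
    exact mul_nonneg (hw0 y hy) (sub_nonneg.2 (laplaceExp_le_one (hpos y hy)))
  · simp_rw [h3]
    exact integrableOn_one_sub_laplaceExp hw (fun y hy => hw0 y hy.le) hwM (by positivity) hα

end HetNet
end

noncomputable section
namespace HetNet

/-! ### Intensities in the half-duplex network -/

lemma sum_node {M : Type*} [AddCommMonoid M] (f : Node → M) : ∑ n, f n = f .bs + f .user :=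
  Finset.sum_pair (by decide)

lemma sum_mode {M : Type*} [AddCommMonoid M] (f : Mode → M) : ∑ m, f m = f .FD + f .HD :=
  Finset.sum_pair (by decide)

lemma sum_channel {M : Type*} [AddCommMonoid M] (f : Channel → M) :
    ∑ i, f i = f .one + f .two :=
  Finset.sum_pair (by decide)

variable {Ω : Type*} [MeasurableSpace Ω] {μ : Measure Ω} (p : Params) {Φ : Fin 2 → Ω → Config}

/-- Intensity of the half-duplex interferers of tier `t` on a link. -/
def hdIntensity (k t : Fin 2) (r : ℝ) : Link → ℝ → ℝ
  | .down, y => if r * ratio p k t ≤ y then hdIntensityBS p k t r y else 0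
  | .up, y => hdIntensityUser p k t y

lemma hdIntensityBS_nonneg (k t : Fin 2) (r y : ℝ) : 0 ≤ hdIntensityBS p k t r y := by
  have h1 := p.lam_pos t
  have h2 := p.lamU_pos
  rw [hdIntensityBS]
  split_ifs
  · exact h1.le
  · refine mul_nonneg h1.le (sub_nonneg.2 (Real.exp_le_one_iff.2 (neg_nonpos.2 ?_)))
    positivity

lemma hdIntensityBS_le (k t : Fin 2) (r y : ℝ) : hdIntensityBS p k t r y ≤ p.lam t := by
  have h1 := p.lam_pos t
  rw [hdIntensityBS]
  split_ifs
  · exact le_rfl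
  · exact mul_le_of_le_one_right h1.le (sub_le_self _ (Real.exp_pos _).le)

lemma hdIntensityUser_nonneg (k t : Fin 2) (y : ℝ) : 0 ≤ hdIntensityUser p k t y := by
  have h1 := p.lam_pos t
  have h2 := p.P_pos t
  have h3 := p.P_pos k
  rw [hdIntensityUser]
  refine mul_nonneg h1.le (sub_nonneg.2 (Real.exp_le_one_iff.2 (neg_nonpos.2 ?_)))
  positivity

lemma hdIntensity_nonneg (k t : Fin 2) (r : ℝ) (l : Link) (y : ℝ) :
    0 ≤ hdIntensity p k t r l y := by
  cases l
  · simp only [hdIntensity]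
    split_ifs
    · exact hdIntensityBS_nonneg p k t r y
    · exact le_rfl
  · exact hdIntensityUser_nonneg p k t y

lemma hdIntensity_le (k t : Fin 2) (r : ℝ) (l : Link) (y : ℝ) :
    hdIntensity p k t r l y ≤ p.lam t := by
  have h1 := p.lam_pos t
  cases l
  · simp only [hdIntensity]
    split_ifs
    · exact hdIntensityBS_le p k t r y
    · exact h1.le
  · exact mul_le_of_le_one_right h1.le (sub_le_self _ (Real.exp_pos _).le)

lemma measurable_hdIntensity (k t : Fin 2) (r : ℝ) (l : Link) :
    Measurable (hdIntensity p k t r l) := by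
  cases l
  · refine Measurable.ite measurableSet_Ici ?_ measurable_const
    unfold hdIntensityBS
    split_ifs <;> fun_prop
  · unfold hdIntensity hdIntensityUser
    fun_prop

lemma oneSubExpNeg_ofReal {a : ℝ} (ha : 0 ≤ a) :
    oneSubExpNeg (ENNReal.ofReal a) = ENNReal.ofReal (1 - Real.exp (-a)) := by
  rw [oneSubExpNeg_eq, expNeg_ofReal ha, ENNReal.ofReal_sub _ (Real.exp_pos _).le,
    ENNReal.ofReal_one]

lemma delta_halfDuplex (t : Fin 2) : delta p halfDuplex t = 0 := by
  have := p.α_pos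
  simp [delta, halfDuplex, ENNReal.zero_rpow_of_pos, this]

lemma one_lt_ratio_iff (k t : Fin 2) : 1 < ratio p t k ↔ p.P t < p.P k := by
  have := p.P_pos t
  have := p.P_pos k
  have := p.α_pos
  rw [ratio, Real.one_lt_rpow_iff_of_pos (by positivity), one_lt_div (by assumption)]
  have : ¬ 1 / p.α < 0 := not_lt.2 (by positivity)
  have : 0 < 1 / p.α := by positivity
  have : ¬ p.α < 0 := not_lt.2 p.α_pos.le
  simp [*]

/-- In the half-duplex network a base station is active with the probability that there is a
user in its coverage region. -/
lemma mul_activeBS_HD (k t : Fin 2) {r y : ℝ} (hr : 0 < r) (hy : 0 ≤ y) :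
    ENNReal.ofReal (p.lam t) * activeBS p halfDuplex t (zeta p k t r y .down) .HD =
      ENNReal.ofReal (hdIntensityBS p k t r y) := by
  have hU := p.lamU_pos
  have hpos : 0 < r + y := by positivity
  rw [activeBS, delta_halfDuplex, zeta, hdIntensityBS]
  rcases le_or_gt (p.P k) (p.P t) with h | h
  · have h1 : ratio p t k ≤ 1 := not_lt.1 fun h' => not_lt.2 h ((one_lt_ratio_iff p k t).1 h')
    -- The denominator of `zeta` vanishes, so the coverage radius is `⊤` and the station is active
    -- with probability one.
    rw [if_pos h, max_eq_right (by linarith), ENNReal.ofReal_zero, ENNReal.div_zero (by simpa)]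
    have h2 : ENNReal.ofReal (p.lamU * Real.pi) * (⊤ ^ 2 - 0 ^ 2) = ⊤ := by
      have : ENNReal.ofReal (p.lamU * Real.pi) ≠ 0 := by
        simpa using (mul_pos hU Real.pi_pos)
      simp [ENNReal.mul_top this]
    rw [h2, if_neg (by simp), oneSubExpNeg_eq]
    simp
  · have h1 : 1 < ratio p t k := (one_lt_ratio_iff p k t).2 h
    have h2 : 0 < ratio p t k - 1 := by linarith
    -- The inactive branch of `activeBS` would need a coverage radius at most zero; `r + y > 0`
    -- excludes it.
    rw [if_neg (not_le.2 h), max_eq_left h2.le, ← ENNReal.ofReal_div_of_pos h2, if_neg,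
      ← ENNReal.ofReal_pow (by positivity), zero_pow two_ne_zero, tsub_zero,
      ← ENNReal.ofReal_mul (by positivity), oneSubExpNeg_ofReal (by positivity),
      ← ENNReal.ofReal_mul (p.lam_pos t).le]
    · rfl
    · simp only [not_le, ENNReal.ofReal_pos]
      positivity

variable (hΦ : ∀ k, IsPoisson μ (Φ k) (ENNReal.ofReal (p.lam k) • (volume : Measure Plane)))
  (hind : iIndepFun Φ μ)

include hΦ in
lemma modeDensity_FD (t : Fin 2) : modeDensity p halfDuplex μ Φ t .FD = 0 := by
  simp [modeDensity, modeProb_FD p hΦ]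

include hΦ hind in
lemma modeDensity_HD (t : Fin 2) :
    modeDensity p halfDuplex μ Φ t .HD = ENNReal.ofReal (p.lam t) := by
  have := (tierProb_pos p t).ne'
  rw [modeDensity, modeProb_HD p hΦ, assocProb_eq p hΦ hind, div_self this, one_mul]

include hΦ in
lemma intensityMeasure_FD (k t : Fin 2) (l : Link) (r : ℝ) (n : Node) :
    intensityMeasure p halfDuplex μ Φ k l r (t, n, .FD) = 0 := by
  rw [intensityMeasure]
  cases n <;> simp [intensity, modeDensity_FD p hΦ]

include hΦ hind in
lemma intensityMeasure_HD (k t : Fin 2) (l : Link) {r : ℝ} (hr : 0 < r) :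
    intensityMeasure p halfDuplex μ Φ k l r (t, sender l, .HD) =
      (volume : Measure Plane).withDensity
        fun x => ENNReal.ofReal (hdIntensity p k t r l ‖x‖) := by
  rw [intensityMeasure]
  congr 1
  funext x
  cases l
  · simp only [sender, intensity, modeDensity_HD p hΦ hind,
      mul_activeBS_HD p k t hr (norm_nonneg x), exclBS, hdIntensity]
    split_ifs <;> simp
  · have h1 : ratio p k t ^ 2 = (p.P t / p.P k) ^ (2 / p.α) := by
      have := p.P_pos t
      have := p.P_pos k
      rw [ratio, ← Real.rpow_natCast, ← Real.rpow_mul (by positivity)]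
      congr 1; push_cast; ring
    simp only [sender, intensity, modeDensity_HD p hΦ hind, exclUser, delta_halfDuplex, activeUser,
      hdIntensity, hdIntensityUser, mul_zero, zero_le, if_true, mul_one, h1]
    rw [ENNReal.ofReal_mul (p.lam_pos t).le]

lemma oneSubExpNeg_le_one (x : ℝ≥0∞) : oneSubExpNeg x ≤ 1 := tsub_le_self

lemma intensity_le (γ : Fin 2 → ℝ≥0∞) (k t : Fin 2) (l : Link) (r y : ℝ) (n : Node) (m : Mode) :
    intensity p γ μ Φ k l r y (t, n, m) ≤ modeDensity p γ μ Φ t m := by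
  cases n
  · simp only [intensity]
    rw [mul_assoc]
    refine mul_le_of_le_one_right zero_le (mul_le_one' ?_ ?_)
    · cases m
      · exact oneSubExpNeg_le_one _
      · simp only [activeBS]
        split_ifs
        · exact zero_le
        · exact oneSubExpNeg_le_one _
    · cases l <;> simp only [exclBS] <;> split_ifs <;>
        simp only [le_refl, zero_le, ENNReal.ofReal_le_one, sub_le_self_iff, sq_nonneg]
  · simp only [intensity]
    rw [mul_assoc]
    refine mul_le_of_le_one_right zero_le (mul_le_one' ?_ ?_)
    · cases l <;> simp only [activeUser, ENNReal.ofReal_le_one, sub_le_self_iff] <;>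
        exact (Real.exp_pos _).le
    · cases l <;> cases m <;> simp only [exclUser] <;> split_ifs <;> simp

/-- All thinning and exclusion factors are at most one, so the intensity is dominated by a finite
multiple of Lebesgue measure. The Laplace functional requires this. -/
instance sigmaFinite_intensityMeasure (γ : Fin 2 → ℝ≥0∞) (k : Fin 2) (l : Link) (r : ℝ) (j : Idx) :
    SigmaFinite (intensityMeasure p γ μ Φ k l r j) := by
  obtain ⟨t, n, m⟩ := j
  have h : intensityMeasure p γ μ Φ k l r (t, n, m) ≤
      (volume : Measure Plane).withDensity fun _ => modeDensity p γ μ Φ t m :=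
    withDensity_mono (.of_forall fun x => intensity_le p γ k t l r _ n m)
  rw [withDensity_const] at h
  -- `modeDensity` is an `ENNReal.ofReal`, hence by definition the coercion of a scalar in `ℝ≥0`.
  have : SigmaFinite (modeDensity p γ μ Φ t m • (volume : Measure Plane)) :=
    inferInstanceAs (SigmaFinite ((Real.toNNReal _ : ℝ≥0) • (volume : Measure Plane)))
  exact Measure.sigmaFinite_of_le _ h

/-! ### Laplace transform of the interference -/

open Classical in
/-- The power received on channel `i` from a node with label `j`, position `z.1` and fading
`z.2`. -/
def nodePower (i : Channel) (j : Idx) (z : Plane × ℝ) : ℝ≥0∞ :=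
  if transmits i j.2.1 j.2.2
    then ENNReal.ofReal (txPower p j.1 j.2.1 * z.2) * ‖z.1‖ₑ ^ (-p.α) else 0

lemma measurable_nodePower (i : Channel) (j : Idx) : Measurable (nodePower p i j) := by
  unfold nodePower
  split_ifs <;> fun_prop

/-- Letting labels silent on the channel carry power zero makes the interference a single sum over
all labels, as the Laplace functional of a family needs. -/
lemma sum_interference (i : Channel) (e : Env) :
    ∑ t, interference p i t e = ∑ j, markedSum (nodePower p i j) (e.2.1 j) (e.2.2 j) := by
  rw [Fintype.sum_prod_type]
  refine Finset.sum_congr rfl fun t _ => ?_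
  rw [Fintype.sum_prod_type, interference]
  refine Finset.sum_congr rfl fun n _ => Finset.sum_congr rfl fun m _ => ?_
  split_ifs with h
  · simp [markedSum, received, nodePower, h]
  · simp [markedSum, nodePower, h]

lemma measurable_sum_interference (i : Channel) :
    Measurable fun e : Env => ∑ t, interference p i t e := by
  simp_rw [sum_interference]
  refine Finset.measurable_fun_sum _ fun j _ => measurable_markedSum (measurable_nodePower p i j) ?_ ?_
  · exact (measurable_pi_apply j).comp (measurable_fst.comp measurable_snd)
  · exact (measurable_pi_apply j).comp (measurable_snd.comp measurable_snd)

lemma txPower_pos (t : Fin 2) (n : Node) : 0 < txPower p t n := by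
  cases n
  · exact p.P_pos t
  · exact p.PU_pos

/-- The Laplace exponent of the interference from tier `t`. -/
def hdExponent (k t : Fin 2) (r : ℝ) (l : Link) (s : ℝ) : ℝ :=
  2 * Real.pi * ∫ y in Set.Ioi (0 : ℝ), hdIntensity p k t r l y * y *
    (1 - laplaceExp (s * txPower p t (sender l) / y ^ p.α))

lemma hdExponent_nonneg (k t : Fin 2) (r : ℝ) (l : Link) {s : ℝ} (hs : 0 ≤ s) :
    0 ≤ hdExponent p k t r l s := by
  refine mul_nonneg (by positivity) (setIntegral_nonneg measurableSet_Ioi fun y hy => ?_)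
  have hy0 : (0 : ℝ) < y := hy
  have := txPower_pos p t (sender l)
  exact mul_nonneg (mul_nonneg (hdIntensity_nonneg p k t r l y) hy0.le)
    (sub_nonneg.2 (laplaceExp_le_one (by positivity)))

include hΦ hind in
-- Full-duplex labels have zero intensity, and half-duplex nodes of the wrong kind have zero power
-- on the channel. The remaining kind is that of the desired transmitter.
lemma laplaceExponent_nodePower (k t : Fin 2) (i : Channel) {r s : ℝ} (hr : 0 < r) (hs : 0 ≤ s)
    (n : Node) (m : Mode) :
    ∫⁻ x, (1 - ∫⁻ h, expNeg (ENNReal.ofReal s * nodePower p i (t, n, m) (x, h)) ∂(expMeasure 1))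
      ∂(intensityMeasure p halfDuplex μ Φ k (hdLink i) r (t, n, m)) =
      if n = sender (hdLink i) ∧ m = .HD
        then ENNReal.ofReal (hdExponent p k t r (hdLink i) s) else 0 := by
  cases m
  · simp [intensityMeasure_FD p hΦ]
  · have hmain : ∀ l, ∫⁻ x, (1 - ∫⁻ h, expNeg (ENNReal.ofReal s *
        (ENNReal.ofReal (txPower p t (sender l) * h) * ‖x‖ₑ ^ (-p.α))) ∂(expMeasure 1))
        ∂(intensityMeasure p halfDuplex μ Φ k l r (t, sender l, .HD)) =
        ENNReal.ofReal (hdExponent p k t r l s) := by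
      intro l
      rw [intensityMeasure_HD p hΦ hind k t l hr, laplaceExponent_radial
        (measurable_hdIntensity p k t r l) (fun y _ => hdIntensity_nonneg p k t r l y)
        (fun y _ => hdIntensity_le p k t r l y) hs (txPower_pos p t (sender l)) p.two_lt_α]
      rfl
    cases i <;> cases n
    · simpa [nodePower, transmits, hdLink, sender] using hmain .down
    · simp [nodePower, transmits, hdLink, sender]
    · simp [nodePower, transmits, hdLink, sender]
    · simpa [nodePower, transmits, hdLink, sender] using hmain .up

include hΦ hind in
lemma sum_laplaceExponent (k : Fin 2) (i : Channel) {r s : ℝ} (hr : 0 < r) (hs : 0 ≤ s) :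
    ∑ j, ∫⁻ x, (1 - ∫⁻ h, expNeg (ENNReal.ofReal s * nodePower p i j (x, h)) ∂(expMeasure 1))
      ∂(intensityMeasure p halfDuplex μ Φ k (hdLink i) r j) =
      ∑ t, ENNReal.ofReal (hdExponent p k t r (hdLink i) s) := by
  rw [Fintype.sum_prod_type]
  refine Finset.sum_congr rfl fun t _ => ?_
  rw [Fintype.sum_prod_type]
  simp_rw [laplaceExponent_nodePower p hΦ hind k t i hr hs, sum_node, sum_mode]
  cases i <;> simp [hdLink, sender]

include hΦ hind in
lemma lintegral_expNeg_interference (k : Fin 2) (i : Channel) {r s : ℝ} (hr : 0 < r) (hs : 0 ≤ s)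
    {ν : Idx → Measure Config} [∀ j, IsProbabilityMeasure (ν j)]
    (hν : ∀ j, IsPoisson (ν j) id (intensityMeasure p halfDuplex μ Φ k (hdLink i) r j)) :
    ∫⁻ z, expNeg (ENNReal.ofReal s *
      ∑ j, markedSum (nodePower p i j) (z.1 j) (z.2 j)) ∂((Measure.pi ν).prod
      (Measure.pi fun _ : Idx => Measure.infinitePi fun _ : ℕ => expMeasure 1)) =
      ∏ t, ENNReal.ofReal (Real.exp (-hdExponent p k t r (hdLink i) s)) := by
  have h1 : ∀ z : (Idx → Config) × (Idx → ℕ → ℝ),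
      ENNReal.ofReal s * ∑ j, markedSum (nodePower p i j) (z.1 j) (z.2 j) =
      ∑ j, markedSum (fun x => ENNReal.ofReal s * nodePower p i j x) (z.1 j) (z.2 j) := by
    intro z
    simp only [Finset.mul_sum, markedSum, ← ENNReal.tsum_mul_left]
    refine Finset.sum_congr rfl fun j _ => tsum_congr fun n => ?_
    by_cases hn : (n : ℕ∞) < (z.1 j).1 <;> simp [Set.indicator, hn]
  simp_rw [h1]
  rw [lintegral_expNeg_sum_markedSum hν
    (F := fun j x => ENNReal.ofReal s * nodePower p i j x)
    (fun j => measurable_const.mul (measurable_nodePower p i j)),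
    sum_laplaceExponent p hΦ hind k i hr hs, expNeg_sum]
  refine Finset.prod_congr rfl fun t _ => ?_
  rw [expNeg_ofReal (hdExponent_nonneg p k t r _ hs)]

include hΦ hind in
-- Needed for the case `T = 0`: infinite interference would make the SINR zero, while `exp (-0 * ⊤)
-- = 1`.
lemma ae_interference_ne_top (k : Fin 2) (i : Channel) {r : ℝ} (hr : 0 < r)
    {ν : Idx → Measure Config} [∀ j, IsProbabilityMeasure (ν j)]
    (hν : ∀ j, IsPoisson (ν j) id (intensityMeasure p halfDuplex μ Φ k (hdLink i) r j)) :
    ∀ᵐ z ∂((Measure.pi ν).prod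
      (Measure.pi fun _ : Idx => Measure.infinitePi fun _ : ℕ => expMeasure 1)),
      ∑ j, markedSum (nodePower p i j) (z.1 j) (z.2 j) ≠ ⊤ := by
  refine ae_sum_markedSum_ne_top hν (measurable_nodePower p i) (fun j => ?_) (fun j => ?_)
  · have hne : ∀ᵐ x : Plane, x ≠ 0 := by simp [ae_iff]
    refine (withDensity_absolutelyContinuous _ _).ae_le ?_
    filter_upwards [hne] with x hx t
    rw [nodePower]
    split_ifs
    · refine ENNReal.mul_ne_top ENNReal.ofReal_ne_top (ENNReal.rpow_ne_top_of_ne_zero ?_ ?_)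
      · simpa using hx
      · simp
    · simp
  · obtain ⟨t, n, m⟩ := j
    have := laplaceExponent_nodePower p hΦ hind k t i hr zero_le_one n m
    simp only [ENNReal.ofReal_one, one_mul] at this
    rw [this]
    split_ifs <;> simp

/-! ### The conditional SINR distribution -/

lemma lt_sinr_iff (k : Fin 2) (l : Link) (i : Channel) {r T : ℝ} (hr : 0 < r) (hT : 0 ≤ T)
    (e : Env) : T < sinr p k .HD l i r e ↔ (∑ t, interference p i t e ≠ ⊤ ∧
      T * r ^ p.α / txPower p k (sender l) *
        ((∑ t, interference p i t e).toReal + p.noise) < e.1) := by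
  have hN := p.noise_pos
  have htx := txPower_pos p k (sender l)
  have hself : selfInterference p k l .HD = 0 := by cases l <;> rfl
  rw [sinr, hself, ENNReal.ofReal_zero, zero_add]
  by_cases hI : ∑ t, interference p i t e = ⊤
  · simp [hI, hT]
  · set I := ∑ t, interference p i t e
    have hI0 : 0 ≤ I.toReal := ENNReal.toReal_nonneg
    have hpos : 0 < I.toReal + p.noise := by positivity
    have h1 : I + ENNReal.ofReal p.noise = ENNReal.ofReal (I.toReal + p.noise) := by
      rw [ENNReal.ofReal_add hI0 hN.le, ENNReal.ofReal_toReal hI]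
    -- The truncation at zero, active for negative values of the fading variable, is harmless
    -- because `T ≥ 0`.
    rw [h1, ← ENNReal.ofReal_div_of_pos hpos, ENNReal.toReal_ofReal', lt_max_iff,
      or_iff_left (not_lt.2 hT), lt_div_iff₀ hpos, Real.rpow_neg hr.le, ← div_eq_mul_inv,
      lt_div_iff₀ (by positivity)]
    simp only [ne_eq, hI, not_false_eq_true, true_and]
    rw [div_mul_eq_mul_div, div_lt_iff₀ htx, mul_comm e.1]
    ring_nf

lemma measurable_sinr (k : Fin 2) (m : Mode) (l : Link) (i : Channel) :
    Measurable fun z : ℝ × Env => sinr p k m l i z.1 z.2 := by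
  unfold sinr
  have : Measurable fun z : ℝ × Env => ∑ t, interference p i t z.2 :=
    (measurable_sum_interference p i).comp measurable_snd
  fun_prop

lemma measurableSet_lt_sinr (k : Fin 2) (m : Mode) (l : Link) (i : Channel) (T : ℝ) :
    MeasurableSet {z : ℝ × Env | T < sinr p k m l i z.1 z.2} :=
  measurableSet_lt measurable_const (measurable_sinr p k m l i)

lemma measurableSet_lt_sinr_right (k : Fin 2) (m : Mode) (l : Link) (i : Channel) (T r : ℝ) :
    MeasurableSet {e : Env | T < sinr p k m l i r e} := by
  have h : Measurable fun e : Env => ((r, e) : ℝ × Env) := measurable_prodMk_left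
  exact h (measurableSet_lt_sinr p k m l i T)

/-- The exponential tail is multiplicative, which separates noise from interference. -/
lemma expMeasure_lt_sinr (k : Fin 2) (l : Link) (i : Channel) {r T : ℝ} (hr : 0 < r) (hT : 0 ≤ T)
    (z : (Idx → Config) × (Idx → ℕ → ℝ))
    (hz : ∑ j, markedSum (nodePower p i j) (z.1 j) (z.2 j) ≠ ⊤) :
    expMeasure 1 {h | T < sinr p k .HD l i r (h, z)} =
      ENNReal.ofReal (Real.exp (-(T * r ^ p.α / txPower p k (sender l) * p.noise))) *
        expNeg (ENNReal.ofReal (T * r ^ p.α / txPower p k (sender l)) *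
          ∑ j, markedSum (nodePower p i j) (z.1 j) (z.2 j)) := by
  have htx := txPower_pos p k (sender l)
  have hN := p.noise_pos
  have hs : 0 ≤ T * r ^ p.α / txPower p k (sender l) := by positivity
  simp_rw [lt_sinr_iff p k l i hr hT, sum_interference]
  generalize T * r ^ p.α / txPower p k (sender l) = s at *
  generalize ∑ j, markedSum (nodePower p i j) (z.1 j) (z.2 j) = I at *
  have hI0 : 0 ≤ I.toReal := ENNReal.toReal_nonneg
  have hset : {h : ℝ | I ≠ ⊤ ∧ s * (I.toReal + p.noise) < h} =
      Set.Ioi (s * (I.toReal + p.noise)) := by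
    ext h
    exact and_iff_right hz
  rw [hset, expMeasure_Ioi (by positivity)]
  nth_rewrite 2 [← ENNReal.ofReal_toReal hz]
  rw [← ENNReal.ofReal_mul hs, expNeg_ofReal (by positivity),
    ← ENNReal.ofReal_mul (Real.exp_pos _).le, ← Real.exp_add]
  congr 2; ring

include hΦ hind in
theorem envLaw_lt_sinr (k : Fin 2) (i : Channel) {r T : ℝ} (hr : 0 < r) (hT : 0 ≤ T)
    {Q : Measure Env} (hQ : IsEnvLaw p halfDuplex μ Φ k (hdLink i) r Q) :
    Q {e | T < sinr p k .HD (hdLink i) i r e} =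
      ENNReal.ofReal (Real.exp (-(T * r ^ p.α / txPower p k (sender (hdLink i)) * p.noise)) *
        ∏ t, Real.exp (-hdExponent p k t r (hdLink i)
          (T * r ^ p.α / txPower p k (sender (hdLink i))))) := by
  obtain ⟨ν, hprob, hν, hQ⟩ := hQ
  have htx := txPower_pos p k (sender (hdLink i))
  have hs : 0 ≤ T * r ^ p.α / txPower p k (sender (hdLink i)) := by positivity
  have hm := measurableSet_lt_sinr_right p k .HD (hdLink i) i T r
  rw [hQ, Measure.prod_apply_symm hm]
  have h1 := (ae_interference_ne_top p hΦ hind k i hr hν).mono fun z hz =>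
    expMeasure_lt_sinr p k (hdLink i) i hr hT z hz
  refine (lintegral_congr_ae h1).trans ?_
  rw [lintegral_const_mul' _ _ ENNReal.ofReal_ne_top,
    lintegral_expNeg_interference p hΦ hind k i hr hs hν,
    ENNReal.ofReal_mul (Real.exp_pos _).le,
    ENNReal.ofReal_prod_of_nonneg fun t _ => (Real.exp_pos _).le]

end HetNet
end

noncomputable section
namespace HetNet

variable {Ω : Type*} [MeasurableSpace Ω] {μ : Measure Ω} (p : Params) {Φ : Fin 2 → Ω → Config}

/-! ### The SINR distribution -/

/-- The probability that the SINR exceeds `T`, given the distance `r` to the server. -/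
def hdConditional (k : Fin 2) (i : Channel) (r T : ℝ) : ℝ :=
  Real.exp (-(T * r ^ p.α / txPower p k (sender (hdLink i)) * p.noise)) *
    ∏ t, Real.exp (-hdExponent p k t r (hdLink i)
      (T * r ^ p.α / txPower p k (sender (hdLink i))))

lemma hdConditional_nonneg (k : Fin 2) (i : Channel) (r T : ℝ) : 0 ≤ hdConditional p k i r T :=
  mul_nonneg (Real.exp_pos _).le (Finset.prod_nonneg fun _ _ => (Real.exp_pos _).le)

lemma hdConditional_le (k : Fin 2) (i : Channel) {r T : ℝ} (hr : 0 < r) (hT : 0 ≤ T) :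
    hdConditional p k i r T ≤
      Real.exp (-(T * r ^ p.α / txPower p k (sender (hdLink i)) * p.noise)) := by
  have htx := txPower_pos p k (sender (hdLink i))
  refine mul_le_of_le_one_right (Real.exp_pos _).le
    (Finset.prod_le_one (fun _ _ => (Real.exp_pos _).le) fun t _ => Real.exp_le_one_iff.2 ?_)
  exact neg_nonpos.2 (hdExponent_nonneg p k t r _ (by positivity))

lemma distFactor_nonneg (k : Fin 2) {r : ℝ} (hr : 0 ≤ r) : 0 ≤ distFactor p k r :=
  mul_nonneg hr (Real.exp_pos _).le

variable (hΦ : ∀ k, IsPoisson μ (Φ k) (ENNReal.ofReal (p.lam k) • (volume : Measure Plane)))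
  (hind : iIndepFun Φ μ) (κ : Fin 2 → Link → Kernel ℝ Env) (hκ : ∀ k l, IsMarkovKernel (κ k l))
  (henv : ∀ k l r, 0 < r → IsEnvLaw p halfDuplex μ Φ k l r (κ k l r))

include hΦ hind in
lemma isProbabilityMeasure_distLaw (k : Fin 2) :
    IsProbabilityMeasure (distLaw p halfDuplex μ Φ k .HD) := by
  have hprob := (hΦ k).isProbabilityMeasure
  have h0 : μ (userEvent p halfDuplex Φ k .HD) ≠ 0 := by
    rw [measure_congr (userEvent_HD_ae_eq p hΦ k), measure_assocEvent p hΦ hind]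
    simpa using tierProb_pos p k
  have := cond_isProbabilityMeasure h0
  exact Measure.isProbabilityMeasure_map
    (measurable_nearest.comp (hΦ k).measurable).ennreal_toReal.aemeasurable

include hΦ hind hκ in
lemma isProbabilityMeasure_jointLaw (k : Fin 2) (l : Link) :
    IsProbabilityMeasure (jointLaw p halfDuplex μ Φ κ k .HD l) := by
  have := isProbabilityMeasure_distLaw p hΦ hind k
  have := hκ k l
  unfold jointLaw
  infer_instance

include hΦ hind hκ henv in
lemma jointLaw_lt_sinr (k : Fin 2) (i : Channel) {T : ℝ} (hT : 0 ≤ T) :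
    jointLaw p halfDuplex μ Φ κ k .HD (hdLink i) {z | T < sinr p k .HD (hdLink i) i z.1 z.2} =
      ∫⁻ r in Set.Ioi 0, ENNReal.ofReal
        (2 * Real.pi * p.lam k / tierProb p k * distFactor p k r * hdConditional p k i r T) := by
  have := isProbabilityMeasure_distLaw p hΦ hind k
  have := hκ k (hdLink i)
  have hS := measurableSet_lt_sinr p k .HD (hdLink i) i T
  have hA := tierProb_pos p k
  have hl := p.lam_pos k
  rw [jointLaw, Measure.compProd_apply hS, distLaw_eq p hΦ hind,
    lintegral_withDensity_eq_lintegral_mul₀]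
  · refine setLIntegral_congr_fun measurableSet_Ioi fun r hr => ?_
    have hr0 : (0 : ℝ) < r := hr
    have hd := distFactor_nonneg p k hr0.le
    simp only [Pi.mul_apply]
    have hmul : ENNReal.ofReal (2 * Real.pi * p.lam k / tierProb p k * distFactor p k r *
        hdConditional p k i r T) = ENNReal.ofReal (2 * Real.pi * p.lam k / tierProb p k *
        distFactor p k r) * ENNReal.ofReal (hdConditional p k i r T) :=
      ENNReal.ofReal_mul (by positivity)
    rw [hmul]
    congr 1
    exact envLaw_lt_sinr p hΦ hind k i hr0 hT (henv k (hdLink i) r hr0)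
  · unfold distFactor; fun_prop
  · exact (Kernel.measurable_kernel_prodMk_left hS).aemeasurable

include hΦ hind hκ henv in
lemma coverage_eq (k : Fin 2) (i : Channel) {T : ℝ} (hT : 0 ≤ T) :
    coverage p halfDuplex μ Φ κ k .HD (hdLink i) i T =
      2 * Real.pi * p.lam k / tierProb p k *
        ∫ r in Set.Ioi (0 : ℝ), distFactor p k r * hdConditional p k i r T := by
  have := hκ k (hdLink i)
  have hS := measurableSet_lt_sinr p k .HD (hdLink i) i T
  have hA := tierProb_pos p k
  have hl := p.lam_pos k
  -- Measurability in `r` is inherited from the kernel `κ`, whose value agrees with `hdConditional`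
  -- for `r > 0`, and not read off the iterated integrals.
  have hmeas : AEStronglyMeasurable (fun r => 2 * Real.pi * p.lam k / tierProb p k *
      distFactor p k r * hdConditional p k i r T) (volume.restrict (Set.Ioi 0)) := by
    have h1 : Measurable fun r => 2 * Real.pi * p.lam k / tierProb p k * distFactor p k r *
        (κ k (hdLink i) r (Prod.mk r ⁻¹' {z | T < sinr p k .HD (hdLink i) i z.1 z.2})).toReal := by
      have := (Kernel.measurable_kernel_prodMk_left (κ := κ k (hdLink i)) hS).ennreal_toReal
      have h2 : Measurable (distFactor p k) := by unfold distFactor; fun_prop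
      exact (h2.const_mul _).mul this
    refine h1.aestronglyMeasurable.congr ?_
    refine (ae_restrict_iff' measurableSet_Ioi).2 (.of_forall fun r hr => ?_)
    refine congrArg (2 * Real.pi * p.lam k / tierProb p k * distFactor p k r * ·) ?_
    have := envLaw_lt_sinr p hΦ hind k i hr hT (henv k (hdLink i) r hr)
    exact (congrArg ENNReal.toReal this).trans
      (ENNReal.toReal_ofReal (hdConditional_nonneg p k i r T))
  rw [coverage, Measure.real, jointLaw_lt_sinr p hΦ hind κ hκ henv k i hT,
    ← integral_eq_lintegral_of_nonneg_ae _ hmeas, ← integral_const_mul]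
  · simp_rw [mul_assoc]
  · refine (ae_restrict_iff' measurableSet_Ioi).2 (.of_forall fun r hr => ?_)
    have hd := distFactor_nonneg p k (le_of_lt hr)
    have hc := hdConditional_nonneg p k i r T
    change 0 ≤ _
    positivity

/-- The exclusion zone, so far an indicator inside the intensity, becomes the lower limit of
integration. -/
lemma exp_hdExponent_down (k t : Fin 2) {r : ℝ} (hr : 0 < r) (T : ℝ) :
    Real.exp (-hdExponent p k t r .down (T * r ^ p.α / p.P k)) = hdLaplaceBS p k t r T := by
  rw [hdLaplaceBS, hdExponent]
  congr 3
  have ha : 0 < r * ratio p k t := mul_pos hr (ratio_pos p k t)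
  have h1 : ∀ y, hdIntensity p k t r .down y * y *
      (1 - laplaceExp (T * r ^ p.α / p.P k * txPower p t (sender .down) / y ^ p.α)) =
      (Set.Ici (r * ratio p k t)).indicator (fun y => hdIntensityBS p k t r y * y *
        (1 - laplaceExp (p.P t * T * r ^ p.α / (p.P k * y ^ p.α)))) y := by
    intro y
    have h2 : T * r ^ p.α / p.P k * p.P t / y ^ p.α =
        p.P t * T * r ^ p.α / (p.P k * y ^ p.α) := by
      rw [div_mul_eq_mul_div, div_div]; congr 1; ring
    simp only [hdIntensity, sender, txPower, h2, Set.indicator, Set.mem_Ici]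
    split_ifs <;> simp
  simp_rw [h1]
  rw [setIntegral_indicator measurableSet_Ici]
  have h3 : Set.Ioi 0 ∩ Set.Ici (r * ratio p k t) = Set.Ici (r * ratio p k t) :=
    Set.inter_eq_right.2 fun y hy => lt_of_lt_of_le ha hy
  rw [h3, integral_Ici_eq_integral_Ioi]
  rfl

lemma exp_hdExponent_up (k t : Fin 2) (r T : ℝ) :
    Real.exp (-hdExponent p k t r .up (T * r ^ p.α / p.PU)) = hdLaplaceUser p k t r T := by
  rw [hdLaplaceUser, hdExponent]
  congr 3
  have : T * r ^ p.α / p.PU * txPower p t (sender .up) = T * r ^ p.α :=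
    div_mul_cancel₀ _ p.PU_pos.ne'
  simp_rw [this]
  rfl

lemma noise_exponent {r : ℝ} (hr : 0 < r) (T P : ℝ) :
    T * r ^ p.α / P * p.noise = T / (P * r ^ (-p.α) / p.noise) := by
  have := p.noise_pos
  have hr' : 0 < r ^ p.α := by positivity
  rw [Real.rpow_neg hr.le, div_div_eq_mul_div, ← div_eq_mul_inv, div_div_eq_mul_div]
  ring

/-- The closed form of the SINR distribution on a channel. -/
def hdCoverage (k : Fin 2) : Channel → ℝ → ℝ
  | .one => hdCoverageDown p k
  | .two => hdCoverageUp p k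

include hΦ hind hκ henv in
theorem coverage_eq_hdCoverage (k : Fin 2) (i : Channel) {T : ℝ} (hT : 0 ≤ T) :
    coverage p halfDuplex μ Φ κ k .HD (hdLink i) i T = hdCoverage p k i T := by
  rw [coverage_eq p hΦ hind κ hκ henv k i hT]
  cases i
  · rw [hdCoverage, hdCoverageDown]
    congr 1
    refine setIntegral_congr_fun measurableSet_Ioi fun r hr => ?_
    simp only [hdConditional, hdLink, sender, txPower]
    rw [noise_exponent p hr, show ∏ t, Real.exp (-hdExponent p k t r .down
      (T * r ^ p.α / p.P k)) = ∏ t, hdLaplaceBS p k t r T from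
      Finset.prod_congr rfl fun t _ => exp_hdExponent_down p k t hr T]
    rw [prod_tier k]; ring
  · rw [hdCoverage, hdCoverageUp]
    congr 1
    refine setIntegral_congr_fun measurableSet_Ioi fun r hr => ?_
    simp only [hdConditional, hdLink, sender, txPower, exp_hdExponent_up]
    rw [noise_exponent p hr, prod_tier k]; ring

/-! ### Rates -/

lemma sinr_nonneg (k : Fin 2) (m : Mode) (l : Link) (i : Channel) (r : ℝ) (e : Env) :
    0 ≤ sinr p k m l i r e := ENNReal.toReal_nonneg

lemma intervalIntegral_rate {x : ℝ} (hx : 0 ≤ x) :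
    ∫ t in (0 : ℝ)..x, (Real.log 2)⁻¹ * (1 + t)⁻¹ = Real.logb 2 (1 + x) := by
  rw [intervalIntegral.integral_const_mul, intervalIntegral.integral_comp_add_left
    (fun t => t⁻¹), add_zero, integral_inv_of_pos one_pos (by linarith), div_one, Real.logb,
    div_eq_inv_mul]

/-- Because `x^a ≤ 1 + x ≤ exp x`. -/
lemma exp_neg_le_rpow {x a : ℝ} (hx : 0 < x) (ha : 0 ≤ a) (ha1 : a ≤ 1) :
    Real.exp (-x) ≤ x ^ (-a) := by
  rw [Real.exp_neg, Real.rpow_neg hx.le]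
  refine inv_anti₀ (by positivity) ?_
  have h1 : x ^ a ≤ x + 1 := by
    rcases le_total x 1 with h | h
    · exact (Real.rpow_le_one hx.le h ha).trans (by linarith)
    · exact (Real.rpow_le_rpow_of_exponent_le h ha1).trans (by rw [Real.rpow_one]; linarith)
  exact h1.trans (Real.add_one_le_exp x)

include hΦ hind hκ henv in
-- Dropping the interference leaves the noise factor `exp (-b T r^α)`, and a power bound on it gives
-- decay in `T`, enough for integrability against `dT / (1 + T)`.
lemma exists_jointLaw_lt_sinr_le (k : Fin 2) (i : Channel) :
    ∃ K : ℝ, ∀ T, 0 < T →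
      jointLaw p halfDuplex μ Φ κ k .HD (hdLink i) {z | T < sinr p k .HD (hdLink i) i z.1 z.2} ≤
        ENNReal.ofReal (K * T ^ (-(1 / p.α))) := by
  have hα := p.α_pos
  have hA := tierProb_pos p k
  have hl := p.lam_pos k
  have hq := p.lam_pos (other k)
  have htx := txPower_pos p k (sender (hdLink i))
  have hN := p.noise_pos
  -- With this exponent `(b T r^α)^(-a)` contains exactly `r⁻¹`, which cancels the factor `r` of
  -- `distFactor` and leaves a Gaussian in `r`.
  set a := 1 / p.α with ha
  set c := 2 * Real.pi * p.lam k / tierProb p k with hc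
  set b := p.noise / txPower p k (sender (hdLink i)) with hb
  have hbpos : 0 < b := by positivity
  have hcpos : 0 < c := by positivity
  have ha0 : 0 < a := by positivity
  have ha1 : a ≤ 1 := by
    rw [ha, div_le_one hα]; linarith [p.two_lt_α]
  have hint : Integrable (fun r : ℝ => Real.exp (-(Real.pi * p.lam k) * r ^ 2)) :=
    integrable_exp_neg_mul_sq (by positivity)
  refine ⟨c * b ^ (-a) * ∫ r in Set.Ioi (0 : ℝ), Real.exp (-(Real.pi * p.lam k) * r ^ 2),
    fun T hT => ?_⟩
  rw [jointLaw_lt_sinr p hΦ hind κ hκ henv k i hT.le]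
  have h1 : ∀ r ∈ Set.Ioi (0 : ℝ), c * distFactor p k r * hdConditional p k i r T ≤
      c * b ^ (-a) * T ^ (-a) * Real.exp (-(Real.pi * p.lam k) * r ^ 2) := by
    intro r hr
    have hr0 : (0 : ℝ) < r := hr
    have hx : T * r ^ p.α / txPower p k (sender (hdLink i)) * p.noise = b * T * r ^ p.α := by
      rw [hb]; ring
    have h2 : hdConditional p k i r T ≤ b ^ (-a) * T ^ (-a) * r⁻¹ := by
      refine (hdConditional_le p k i hr0 hT.le).trans ?_
      rw [hx]
      refine (exp_neg_le_rpow (by positivity) ha0.le ha1).trans (le_of_eq ?_)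
      rw [Real.mul_rpow (by positivity) (by positivity), Real.mul_rpow hbpos.le hT.le,
        ← Real.rpow_mul hr0.le, mul_neg, ha, mul_one_div_cancel hα.ne', Real.rpow_neg_one]
    have h3 : distFactor p k r ≤ r * Real.exp (-(Real.pi * p.lam k) * r ^ 2) := by
      rw [distFactor]
      refine mul_le_mul_of_nonneg_left (Real.exp_le_exp.2 ?_) hr0.le
      have : 0 ≤ Real.pi * p.lam (other k) *
        (r * (p.P (other k) / p.P k) ^ (1 / p.α)) ^ 2 := by positivity
      linarith
    calc c * distFactor p k r * hdConditional p k i r T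
        ≤ c * (r * Real.exp (-(Real.pi * p.lam k) * r ^ 2)) * (b ^ (-a) * T ^ (-a) * r⁻¹) := by
          refine mul_le_mul (mul_le_mul_of_nonneg_left h3 hcpos.le) h2
            (hdConditional_nonneg p k i r T) (by positivity)
      _ = _ := by field_simp
  refine (setLIntegral_mono' measurableSet_Ioi fun r hr =>
    ENNReal.ofReal_le_ofReal (h1 r hr)).trans (le_of_eq ?_)
  rw [← ofReal_integral_eq_lintegral_ofReal (hint.integrableOn.const_mul _)
    (.of_forall fun r => by positivity), integral_const_mul]
  congr 1; ring

/-- Integrability at zero uses `a < 1`, at infinity `a > 0`. -/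
lemma integrableOn_rpow_div {a : ℝ} (ha0 : 0 < a) (ha1 : a < 1) :
    IntegrableOn (fun T : ℝ => T ^ (-a) * (1 + T)⁻¹) (Set.Ioi 0) := by
  have hm : Measurable fun T : ℝ => T ^ (-a) * (1 + T)⁻¹ := by fun_prop
  rw [← Set.Ioc_union_Ioi_eq_Ioi zero_le_one]
  refine IntegrableOn.union ?_ ?_
  · have h := intervalIntegral.intervalIntegrable_rpow' (a := 0) (b := 1) (r := -a) (by linarith)
    rw [intervalIntegrable_iff_integrableOn_Ioc_of_le zero_le_one] at h
    refine h.mono' hm.aestronglyMeasurable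
      ((ae_restrict_iff' measurableSet_Ioc).2 (.of_forall fun T hT => ?_))
    have hT0 : 0 < T := hT.1
    rw [Real.norm_of_nonneg (by positivity)]
    exact mul_le_of_le_one_right (by positivity) (inv_le_one_of_one_le₀ (by linarith))
  · refine (integrableOn_Ioi_rpow_of_lt (a := -a - 1) (by linarith) one_pos).mono'
      hm.aestronglyMeasurable ((ae_restrict_iff' measurableSet_Ioi).2 (.of_forall fun T hT => ?_))
    have hT0 : 0 < T := one_pos.trans hT
    rw [Real.norm_of_nonneg (by positivity), Real.rpow_sub hT0, Real.rpow_one, div_eq_mul_inv]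
    exact mul_le_mul_of_nonneg_left (inv_anti₀ hT0 (by linarith)) (by positivity)

lemma measurable_rate (k : Fin 2) (m : Mode) (l : Link) (i : Channel) :
    Measurable (rate p k m l i) := by
  have := measurable_sinr p k m l i
  unfold rate Real.logb
  fun_prop

lemma rate_nonneg (k : Fin 2) (m : Mode) (l : Link) (i : Channel) (z : ℝ × Env) :
    0 ≤ rate p k m l i z :=
  Real.logb_nonneg one_lt_two (by linarith [sinr_nonneg p k m l i z.1 z.2])

/-- The layer cake formula, weighted by the derivative of `log₂ (1 + T)`. -/
lemma lintegral_logb_one_add {α : Type*} [MeasurableSpace α] (J : Measure α) {f : α → ℝ}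
    (hf : Measurable f) (hf0 : ∀ z, 0 ≤ f z) :
    ∫⁻ z, ENNReal.ofReal (Real.logb 2 (1 + f z)) ∂J =
      ∫⁻ T in Set.Ioi 0, J {z | T < f z} * ENNReal.ofReal ((Real.log 2)⁻¹ * (1 + T)⁻¹) := by
  have hlog : 0 < Real.log 2 := Real.log_pos one_lt_two
  rw [← lintegral_comp_eq_lintegral_meas_lt_mul J
    (f := f) (g := fun T => (Real.log 2)⁻¹ * (1 + T)⁻¹) (.of_forall hf0) hf.aemeasurable]
  · refine lintegral_congr fun z => ?_
    rw [intervalIntegral_rate (hf0 z)]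
  · intro t ht
    refine ContinuousOn.intervalIntegrable fun x hx => ContinuousAt.continuousWithinAt ?_
    rw [Set.uIcc_of_le ht.le] at hx
    have : 1 + x ≠ 0 := by linarith [hx.1]
    fun_prop (disch := assumption)
  · refine (ae_restrict_iff' measurableSet_Ioi).2 (.of_forall fun T hT => ?_)
    have hT0 : (0 : ℝ) < T := hT
    change 0 ≤ _
    positivity

lemma lintegral_rate (J : Measure (ℝ × Env)) (k : Fin 2) (m : Mode) (l : Link) (i : Channel) :
    ∫⁻ z, ENNReal.ofReal (rate p k m l i z) ∂J =
      ∫⁻ T in Set.Ioi 0, J {z | T < sinr p k m l i z.1 z.2} *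
        ENNReal.ofReal ((Real.log 2)⁻¹ * (1 + T)⁻¹) :=
  lintegral_logb_one_add J (measurable_sinr p k m l i)
    fun z => sinr_nonneg p k m l i z.1 z.2

/-- A tail is antitone in the threshold. -/
lemma measurable_measure_lt_sinr (J : Measure (ℝ × Env)) (k : Fin 2) (m : Mode) (l : Link)
    (i : Channel) : Measurable fun T => J {z | T < sinr p k m l i z.1 z.2} :=
  Antitone.measurable fun _ _ h => measure_mono fun _ hz => lt_of_le_of_lt h hz

include hΦ hind hκ henv in
lemma lintegral_coverage_lt_top (k : Fin 2) (i : Channel) :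
    ∫⁻ T in Set.Ioi 0, jointLaw p halfDuplex μ Φ κ k .HD (hdLink i)
      {z | T < sinr p k .HD (hdLink i) i z.1 z.2} *
        ENNReal.ofReal ((Real.log 2)⁻¹ * (1 + T)⁻¹) < ⊤ := by
  obtain ⟨K, hK⟩ := exists_jointLaw_lt_sinr_le p hΦ hind κ hκ henv k i
  have hlog : 0 < Real.log 2 := Real.log_pos one_lt_two
  have hα := p.α_pos
  have ha1 : 1 / p.α < 1 := by rw [div_lt_one hα]; linarith [p.two_lt_α]
  have hint := (integrableOn_rpow_div (one_div_pos.2 hα) ha1).const_mul (K * (Real.log 2)⁻¹)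
  refine lt_of_le_of_lt (setLIntegral_mono' measurableSet_Ioi fun T hT => ?_) hint.lintegral_lt_top
  have hT0 : (0 : ℝ) < T := hT
  refine (mul_le_mul_left (hK T hT) _).trans (le_of_eq ?_)
  rw [← ENNReal.ofReal_mul' (by positivity)]
  congr 1; ring

include hΦ hind hκ henv in
theorem integrable_rate (k : Fin 2) (i : Channel) :
    Integrable (rate p k .HD (hdLink i) i) (jointLaw p halfDuplex μ Φ κ k .HD (hdLink i)) := by
  refine ⟨(measurable_rate p k .HD (hdLink i) i).aestronglyMeasurable, ?_⟩
  rw [hasFiniteIntegral_iff_ofReal (.of_forall fun z => rate_nonneg p k .HD (hdLink i) i z),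
    lintegral_rate]
  exact lintegral_coverage_lt_top p hΦ hind κ hκ henv k i

include hΦ hind hκ in
lemma lintegral_rate_eq_coverage (k : Fin 2) (i : Channel) :
    ∫⁻ T in Set.Ioi 0, jointLaw p halfDuplex μ Φ κ k .HD (hdLink i)
      {z | T < sinr p k .HD (hdLink i) i z.1 z.2} *
        ENNReal.ofReal ((Real.log 2)⁻¹ * (1 + T)⁻¹) =
    ∫⁻ T in Set.Ioi 0, ENNReal.ofReal ((Real.log 2)⁻¹ *
      (coverage p halfDuplex μ Φ κ k .HD (hdLink i) i T / (1 + T))) := by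
  have := isProbabilityMeasure_jointLaw p hΦ hind κ hκ k (hdLink i)
  refine setLIntegral_congr_fun measurableSet_Ioi fun T hT => ?_
  have hT0 : (0 : ℝ) < T := hT
  have hlog : 0 < Real.log 2 := Real.log_pos one_lt_two
  rw [← ofReal_measureReal, ← ENNReal.ofReal_mul measureReal_nonneg, coverage]
  congr 1
  ring

lemma coverage_div_nonneg (k : Fin 2) (i : Channel) : 0 ≤ᵐ[volume.restrict (Set.Ioi 0)]
    fun T => (Real.log 2)⁻¹ * (coverage p halfDuplex μ Φ κ k .HD (hdLink i) i T / (1 + T)) := by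
  refine (ae_restrict_iff' measurableSet_Ioi).2 (.of_forall fun T hT => ?_)
  have hT0 : (0 : ℝ) < T := hT
  have h0 : 0 ≤ coverage p halfDuplex μ Φ κ k .HD (hdLink i) i T := measureReal_nonneg
  have hlog : 0 < Real.log 2 := Real.log_pos one_lt_two
  change 0 ≤ _
  positivity

lemma measurable_coverage (k : Fin 2) (i : Channel) :
    Measurable (coverage p halfDuplex μ Φ κ k .HD (hdLink i) i) :=
  (measurable_measure_lt_sinr p _ k .HD (hdLink i) i).ennreal_toReal

include hΦ hind hκ henv in
lemma integrableOn_coverage (k : Fin 2) (i : Channel) :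
    IntegrableOn (fun T => (Real.log 2)⁻¹ *
      (coverage p halfDuplex μ Φ κ k .HD (hdLink i) i T / (1 + T))) (Set.Ioi 0) := by
  have hm := measurable_coverage (μ := μ) (Φ := Φ) p κ k i
  refine ⟨((hm.div (by fun_prop)).const_mul _).aestronglyMeasurable, ?_⟩
  rw [hasFiniteIntegral_iff_ofReal (coverage_div_nonneg p κ k i),
    ← lintegral_rate_eq_coverage p hΦ hind κ hκ k i]
  exact lintegral_coverage_lt_top p hΦ hind κ hκ henv k i

include hΦ hind hκ henv in
theorem integrableOn_hdCoverage (k : Fin 2) (i : Channel) :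
    IntegrableOn (fun T => hdCoverage p k i T / (1 + T)) (Set.Ioi 0) := by
  have h := (integrableOn_coverage p hΦ hind κ hκ henv k i).const_mul (Real.log 2)
  have hlog : 0 < Real.log 2 := Real.log_pos one_lt_two
  refine h.congr ((ae_restrict_iff' measurableSet_Ioi).2 (.of_forall fun T hT => ?_))
  beta_reduce
  rw [coverage_eq_hdCoverage p hΦ hind κ hκ henv k i (le_of_lt hT),
    mul_inv_cancel_left₀ hlog.ne']

include hΦ hind hκ henv in
theorem linkSE_eq (k : Fin 2) (i : Channel) :
    linkSE p halfDuplex μ Φ κ k .HD (hdLink i) i =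
      1 / (2 * Real.log 2) * ∫ T in Set.Ioi (0 : ℝ), hdCoverage p k i T / (1 + T) := by
  have hm := measurable_coverage (μ := μ) (Φ := Φ) p κ k i
  rw [linkSE, integral_eq_lintegral_of_nonneg_ae
    (.of_forall fun z => rate_nonneg p k .HD (hdLink i) i z)
    (measurable_rate p k .HD (hdLink i) i).aestronglyMeasurable, lintegral_rate,
    lintegral_rate_eq_coverage p hΦ hind κ hκ k i,
    ← integral_eq_lintegral_of_nonneg_ae (coverage_div_nonneg p κ k i)
      ((hm.div (by fun_prop)).const_mul _).aestronglyMeasurable,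
    integral_const_mul, ← mul_assoc]
  congr 1
  · rw [one_div_mul_eq_div, one_div, mul_inv, div_eq_inv_mul]
  · refine setIntegral_congr_fun measurableSet_Ioi fun T hT => ?_
    rw [coverage_eq_hdCoverage p hΦ hind κ hκ henv k i (le_of_lt hT)]

end HetNet
end

/-! ### The spectral efficiency of the half-duplex network -/

open HetNet
theorem corollary3 (p : Params) {Ω : Type*} [MeasurableSpace Ω] (μ : Measure Ω)
    [IsProbabilityMeasure μ] (Φ : Fin 2 → Ω → Config)
    (hΦ : ∀ k, IsPoisson μ (Φ k) (ENNReal.ofReal (p.lam k) • (volume : Measure Plane)))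
    (hind : iIndepFun Φ μ)
    (κ : Fin 2 → Link → Kernel ℝ Env) (hκ : ∀ k l, IsMarkovKernel (κ k l))
    (henv : ∀ k l r, 0 < r → IsEnvLaw p halfDuplex μ Φ k l r (κ k l r)) :
    (∀ k, assocProb p μ Φ k = tierProb p k) ∧
    (∀ k T, 0 ≤ T →
      coverage p halfDuplex μ Φ κ k .HD .down .one T = hdCoverageDown p k T ∧
      coverage p halfDuplex μ Φ κ k .HD .up .two T = hdCoverageUp p k T) ∧
    (∀ k i, Integrable (rate p k .HD (hdLink i) i)
      (jointLaw p halfDuplex μ Φ κ k .HD (hdLink i))) ∧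
    (∀ k, IntegrableOn (fun T => (hdCoverageDown p k T + hdCoverageUp p k T) / (1 + T))
      (Set.Ioi 0)) ∧
    spectralEfficiency p halfDuplex μ Φ κ =
      1 / (2 * Real.log 2) * ∑ k, assocProb p μ Φ k *
        ∫ T in Set.Ioi (0 : ℝ), (hdCoverageDown p k T + hdCoverageUp p k T) / (1 + T) := by
  have hint := integrableOn_hdCoverage p hΦ hind κ hκ henv
  have hadd : ∀ k T, (hdCoverageDown p k T + hdCoverageUp p k T) / (1 + T) =
      hdCoverage p k .one T / (1 + T) + hdCoverage p k .two T / (1 + T) := fun k T => add_div _ _ _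
  refine ⟨assocProb_eq p hΦ hind, fun k T hT =>
    ⟨coverage_eq_hdCoverage p hΦ hind κ hκ henv k .one hT,
      coverage_eq_hdCoverage p hΦ hind κ hκ henv k .two hT⟩,
    integrable_rate p hΦ hind κ hκ henv, fun k => ?_, ?_⟩
  · simp_rw [hadd]
    exact (hint k .one).add (hint k .two)
  · simp_rw [hadd]
    rw [spectralEfficiency, Finset.sum_comm, Finset.mul_sum]
    refine Finset.sum_congr rfl fun k _ => ?_
    -- The full-duplex rates are conditioned on a null event, but they are multiplied by its
    -- probability zero and never need to be evaluated.
    rw [integral_add (hint k .one) (hint k .two), sum_channel, modeProb_FD p hΦ,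
      modeProb_HD p hΦ, linkSE_eq p hΦ hind κ hκ henv, linkSE_eq p hΦ hind κ hκ henv]
    ring
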